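/- Let $K$ be a number field with ring of integers $\mathcal{O}_K$, and let $\zeta_K(s)=\sum_{\mathfrak a}\mathfrak{N}\mathfrak{a}^{-s}$ ($\Re s>1$, sum over the nonzero ideals of $\mathcal{O}_K$) be its Dedekind zeta function, analytically continued to $\{s\in\mathbf{C}: \Re s\ge 1/2,\ s\ne1\}$. Assume the Extended Lindelöf Hypothesis for $K$: for every fixed $\sigma\ge 1/2$ and every $\varepsilon>0$, $\zeta_K(\sigma+it)=O(t^{\varepsilon})$ as $t\to\infty$. Let $j_K(x)$ be the number of nonzero ideals of $\mathcal{O}_K$ of norm at most $x$. Then for every $\varepsilon>0$, $$j_K(x)=cx+O(x^{1/2+\varepsilon})\quad (x\to\infty),\qquad c=\frac{2^{r_1}(2\pi)^{r_2}hR}{w\sqrt{|d_K|}},$$ where $r_1$ and $r_2$ are the numbers of real and complex places of $K$ (a pair of conjugate complex embeddings giving one complex place), $h$ is the class number, $R$ the regulator, $w$ the number of roots of unity in $K$, and $d_K$ the discriminant of $K$. The implied constants may depend on $K$ and $\varepsilon$, and the one in the hypothesis also on $\sigma$. -/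

import Mathlib

open Asymptotics Filter NumberField
open scoped nonZeroDivisors Real

/-- `Z` is the analytic continuation of the Dedekind zeta function of `K` to the closed half plane
`Re s ≥ 1/2` with the point `1` removed: it is holomorphic in a neighbourhood of each point of that
(connected) set, and equals `∑ 1 / N(𝔞) ^ s`, the sum over the nonzero ideals, for `Re s > 1`.
By the identity theorem two such `Z` agree on the whole set. -/
def IsDedekindZetaContinuation (K : Type*) [Field K] [NumberField K] (Z : ℂ → ℂ) : Prop :=
  AnalyticOnNhd ℂ Z {s : ℂ | 1 / 2 ≤ s.re ∧ s ≠ 1} ∧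
    ∀ s : ℂ, 1 < s.re → Z s = dedekindZeta K s

/-- The Extended Lindelöf Hypothesis for `K`: for each fixed `σ ≥ 1/2` and each `ε > 0`, one has
`ζ_K(σ + it) = O(t ^ ε)` as `t → ∞`, where `ζ_K` is the analytically continued Dedekind zeta
function. The existence of the continuation is not part of this hypothesis. -/
def ExtendedLindelofHypothesis (K : Type*) [Field K] [NumberField K] : Prop :=
  ∀ Z : ℂ → ℂ, IsDedekindZetaContinuation K Z →
    ∀ σ : ℝ, 1 / 2 ≤ σ → ∀ ε : ℝ, 0 < ε →
      (fun t : ℝ ↦ Z ((σ : ℂ) + (t : ℂ) * Complex.I)) =O[atTop] (fun t : ℝ ↦ t ^ ε)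

/-- `j_K(x)`: the number of nonzero ideals of the ring of integers of `K` of norm at most `x`. -/
noncomputable def idealCount (K : Type*) [Field K] [NumberField K] (x : ℝ) : ℕ :=
  Nat.card {I : (Ideal (𝓞 K))⁰ // (Ideal.absNorm (I : Ideal (𝓞 K)) : ℝ) ≤ x}

/-! ### Smooth sums over integer lattices -/

/-! The error term is read off by Mellin inversion on the line `Re s = 1/2`, applied to smooth sums
`∑ g (t * N I)` with `g` a test function on `(0, ∞)`.

The continuation of the zeta function comes from counting lattice points. In a fixed ideal class,
ideals correspond to unit orbits of nonzero elements of an ideal lattice in the mixed space. A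
smooth partition of unity in logarithmic coordinates turns the sum over orbits into a sum of a
smooth compactly supported function over the lattice (`tsum_idealLattice_normBump`). Such a sum
equals `C / t ^ n + O(1)` (`exists_abs_tsum_smul_intCast_sub_le`), which is proved by comparing the
steps `h` and `2 * h` through repeated summation by parts. Hence `∑ g (t * N I) = C / t + O(1)` as
`t → 0`. After subtraction of a multiple of `poleKernel`, the remainder has a Mellin transform
holomorphic for `0 < Re s`. For `1 < Re s` this transform is the Mellin transform of `g` times zeta,
minus an explicit polar term. Comparison as `s → 1` gives `C` through the class number formula
(`mainTerm_eq`), and division by the transform of `g` defines `continuedZeta`.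

The Lindelöf bound on the critical line, together with decay of the Mellin transform of `g`, makes
the transform of the remainder integrable there. Inversion then gives a remainder `O(t ^ (-1/2))`,
with explicit dependence on two derivatives of `g` (`exists_abs_idealSumRemainder_le`). A cutoff of
the ideal count with transition width `δ` splits into dyadic test functions, and the loss is only `δ
^ (-2ε)`. Taking `δ = x ^ (-1/2)` and sandwiching the sharp count between two smooth ones finishes
the proof. -/

/-- The forward difference of `f` in the direction `v`. -/
def forwardDiff {E : Type*} [AddCommGroup E] (v : E) (f : E → ℝ) (x : E) : ℝ := f (x + v) - f x

section ForwardDiff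

variable {E : Type*} [NormedAddCommGroup E] [NormedSpace ℝ E]

theorem differentiable_forwardDiff {f : E → ℝ} (hf : Differentiable ℝ f) (v : E) :
    Differentiable ℝ (forwardDiff v f) :=
  (hf.comp (differentiable_id.add_const v)).sub hf

theorem fderiv_forwardDiff {f : E → ℝ} (hf : Differentiable ℝ f) (v w : E) :
    (fun x ↦ fderiv ℝ (forwardDiff v f) x w) = forwardDiff v (fun x ↦ fderiv ℝ f x w) := by
  ext x
  have h1 : HasFDerivAt (fun y ↦ f (y + v)) (fderiv ℝ f (x + v)) x :=
    (hasFDerivAt_comp_add_right v).mpr (hf (x + v)).hasFDerivAt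
  have h2 := h1.sub (hf x).hasFDerivAt
  have h3 : fderiv ℝ (forwardDiff v f) x = fderiv ℝ f (x + v) - fderiv ℝ f x := h2.fderiv
  rw [h3]
  rfl

theorem differentiable_iterate_forwardDiff {f : E → ℝ} (hf : Differentiable ℝ f) (v : E) (j : ℕ) :
    Differentiable ℝ ((forwardDiff v)^[j] f) := by
  induction j with
  | zero => exact hf
  | succ j ih => rw [Function.iterate_succ_apply']; exact differentiable_forwardDiff ih v

theorem fderiv_iterate_forwardDiff {f : E → ℝ} (hf : Differentiable ℝ f) (v w : E) (j : ℕ) :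
    (fun x ↦ fderiv ℝ ((forwardDiff v)^[j] f) x w) =
      (forwardDiff v)^[j] (fun x ↦ fderiv ℝ f x w) := by
  induction j with
  | zero => rfl
  | succ j ih =>
    rw [Function.iterate_succ_apply', Function.iterate_succ_apply', ← ih]
    exact fderiv_forwardDiff (differentiable_iterate_forwardDiff hf v j) v w

theorem abs_forwardDiff_le {f : E → ℝ} (hf : Differentiable ℝ f) (v : E) {h M : ℝ} (hh : 0 ≤ h)
    (hM : ∀ x, |fderiv ℝ f x v| ≤ M) (x : E) : |forwardDiff (h • v) f x| ≤ M * h := by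
  have hd : ∀ s : ℝ, HasDerivAt (fun s : ℝ ↦ f (x + s • v)) (fderiv ℝ f (x + s • v) v) s := by
    intro s
    have h1 : HasDerivAt (fun s : ℝ ↦ x + s • v) v s := by
      simpa using ((hasDerivAt_id s).smul_const v).const_add x
    exact (hf _).hasFDerivAt.comp_hasDerivAt s h1
  have := norm_image_sub_le_of_norm_deriv_le_segment' (f := fun s : ℝ ↦ f (x + s • v))
    (f' := fun s ↦ fderiv ℝ f (x + s • v) v) (C := M) (a := 0) (b := h)
    (fun s _ ↦ (hd s).hasDerivWithinAt) (fun s _ ↦ hM _) h ⟨hh, le_rfl⟩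
  simpa [forwardDiff] using this

/-- The `j`-th difference with step `h` of a smooth compactly supported function is `O(h ^ j)`. -/
theorem exists_abs_iterate_forwardDiff_le (v : E) (j : ℕ) :
    ∀ f : E → ℝ, ContDiff ℝ (⊤ : ℕ∞) f → HasCompactSupport f →
      ∃ M, ∀ h : ℝ, 0 ≤ h → ∀ x, |(forwardDiff (h • v))^[j] f x| ≤ M * h ^ j := by
  induction j with
  | zero =>
    intro f hf hs
    obtain ⟨M, hM⟩ := hs.exists_bound_of_continuous hf.continuous
    exact ⟨M, fun h _ x ↦ by simpa using hM x⟩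
  | succ j ih =>
    intro f hf hs
    have hd : Differentiable ℝ f := hf.differentiable (by simp)
    obtain ⟨M, hM⟩ := ih (fun x ↦ fderiv ℝ f x v)
      ((hf.fderiv_right (m := (⊤ : ℕ∞)) (by simp)).clm_apply contDiff_const) (hs.fderiv_apply ℝ v)
    refine ⟨M, fun h hh x ↦ ?_⟩
    rw [Function.iterate_succ_apply']
    refine (abs_forwardDiff_le (differentiable_iterate_forwardDiff hd _ j) v hh
      (M := M * h ^ j) (fun y ↦ ?_) x).trans (by rw [pow_succ, mul_assoc])
    rw [congrFun (fderiv_iterate_forwardDiff hd (h • v) v j) y]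
    exact hM h hh y

theorem iterate_forwardDiff_eq_zero {E : Type*} [NormedAddCommGroup E] {f : E → ℝ} {R : ℝ} (hf : ∀ x, R < ‖x‖ → f x = 0) {v : E}
    (hv : ‖v‖ ≤ 1) (j : ℕ) : ∀ x, R + j < ‖x‖ → (forwardDiff v)^[j] f x = 0 := by
  induction j with
  | zero => intro x hx; exact hf x (by simpa using hx)
  | succ j ih =>
    intro x hx
    rw [Function.iterate_succ_apply']
    push_cast at hx
    have : ‖x‖ ≤ ‖x + v‖ + ‖v‖ := by simpa using norm_sub_le (x + v) v
    rw [forwardDiff, ih _ (by linarith), ih _ (by linarith), sub_zero]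

end ForwardDiff

section IntegerLattice

open scoped Pointwise

variable {ι : Type*} [Fintype ι]

/-- Only finitely many points of `h • ℤ^ι` lie in a ball. -/
theorem finite_norm_smul_intCast_le {h : ℝ} (hh : 0 < h) (R : ℝ) :
    {k : ι → ℤ | ‖h • (fun i ↦ (k i : ℝ))‖ ≤ R}.Finite := by
  classical
  refine (Set.finite_Icc (fun _ : ι ↦ -⌊R / h⌋) (fun _ : ι ↦ ⌊R / h⌋)).subset fun k hk ↦ ?_
  have hk' : ∀ i, |(k i : ℝ)| ≤ R / h := fun i ↦ by
    rw [le_div_iff₀ hh]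
    have := (norm_le_pi_norm (h • (fun i ↦ (k i : ℝ))) i).trans hk
    simpa [abs_mul, abs_of_pos hh, mul_comm] using this
  refine ⟨fun i ↦ ?_, fun i ↦ ?_⟩
  · rw [neg_le]
    exact Int.le_floor.mpr (by push_cast; exact (neg_le_abs _).trans (hk' i))
  · exact Int.le_floor.mpr ((le_abs_self _).trans (hk' i))

theorem finite_support_smul_intCast {f : (ι → ℝ) → ℝ} {R : ℝ} (hf : ∀ x, R < ‖x‖ → f x = 0)
    {h : ℝ} (hh : 0 < h) : (Function.support fun k : ι → ℤ ↦ f (h • fun i ↦ (k i : ℝ))).Finite := by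
  refine (finite_norm_smul_intCast_le hh R).subset fun k hk ↦ ?_
  by_contra hc
  exact hk (hf _ (not_le.mp hc))

theorem ncard_norm_smul_intCast_le {h R : ℝ} (hh : 0 < h) (h1 : h ≤ 1) (hR : 0 ≤ R) :
    ({k : ι → ℤ | ‖h • (fun i ↦ (k i : ℝ))‖ ≤ R}.ncard : ℝ) ≤
      ((2 * R + 1) / h) ^ Fintype.card ι := by
  classical
  have hsub : {k : ι → ℤ | ‖h • (fun i ↦ (k i : ℝ))‖ ≤ R} ⊆
      ↑(Finset.Icc (fun _ : ι ↦ -⌊R / h⌋) (fun _ : ι ↦ ⌊R / h⌋)) := by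
    intro k hk
    have hk' : ∀ i, |(k i : ℝ)| ≤ R / h := fun i ↦ by
      rw [le_div_iff₀ hh]
      have := (norm_le_pi_norm (h • (fun i ↦ (k i : ℝ))) i).trans hk
      simpa [abs_mul, abs_of_pos hh, mul_comm] using this
    rw [Finset.coe_Icc]
    refine ⟨fun i ↦ ?_, fun i ↦ ?_⟩
    · rw [neg_le]
      exact Int.le_floor.mpr (by push_cast; exact (neg_le_abs _).trans (hk' i))
    · exact Int.le_floor.mpr ((le_abs_self _).trans (hk' i))
  have hfl : 0 ≤ ⌊R / h⌋ := Int.floor_nonneg.mpr (by positivity)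
  calc ({k : ι → ℤ | ‖h • (fun i ↦ (k i : ℝ))‖ ≤ R}.ncard : ℝ)
      ≤ (Finset.Icc (fun _ : ι ↦ -⌊R / h⌋) (fun _ : ι ↦ ⌊R / h⌋)).card := by
        rw [← Set.ncard_coe_finset]
        exact_mod_cast Set.ncard_le_ncard hsub (Finset.finite_toSet _)
    _ = (2 * (⌊R / h⌋ : ℝ) + 1) ^ Fintype.card ι := by
        rw [Pi.card_Icc]
        simp only [Int.card_Icc, sub_neg_eq_add, Finset.prod_const, Finset.card_univ]
        push_cast
        congr 1
        have : (((⌊R / h⌋ + 1 + ⌊R / h⌋).toNat : ℤ) : ℝ) = ((⌊R / h⌋ + 1 + ⌊R / h⌋ : ℤ) : ℝ) := by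
          rw [Int.toNat_of_nonneg (by omega)]
        push_cast at this
        rw [this]; ring
    _ ≤ ((2 * R + 1) / h) ^ Fintype.card ι := by
        have := Int.floor_le (R / h)
        have h2 : (1 : ℝ) ≤ 1 / h := by rwa [le_div_iff₀ hh, one_mul]
        have h3 : (0 : ℝ) ≤ ⌊R / h⌋ := by exact_mod_cast hfl
        refine pow_le_pow_left₀ (by positivity) ?_ _
        rw [add_div, mul_div_assoc]
        linarith

theorem abs_tsum_mul_smul_intCast_le {f : (ι → ℝ) → ℝ} {R B : ℝ} (hR : 0 ≤ R)
    (hf : ∀ x, R < ‖x‖ → f x = 0) (hB : ∀ x, |f x| ≤ B) {χ : (ι → ℤ) → ℝ} (hχ : ∀ k, |χ k| ≤ 1)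
    {h : ℝ} (hh : 0 < h) (h1 : h ≤ 1) :
    |∑' k : ι → ℤ, χ k * f (h • fun i ↦ (k i : ℝ))| ≤ B * ((2 * R + 1) / h) ^ Fintype.card ι := by
  have hfin := finite_norm_smul_intCast_le (ι := ι) hh R
  have hB0 : 0 ≤ B := (abs_nonneg _).trans (hB 0)
  rw [tsum_eq_sum (s := hfin.toFinset)]
  · refine (Finset.abs_sum_le_sum_abs _ _).trans ?_
    refine (Finset.sum_le_card_nsmul _ _ B fun k _ ↦ ?_).trans ?_
    · rw [abs_mul]
      exact (mul_le_mul (hχ k) (hB _) (abs_nonneg _) zero_le_one).trans_eq (one_mul B)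
    · rw [nsmul_eq_mul, mul_comm, ← Set.ncard_eq_toFinset_card _ hfin]
      exact mul_le_mul_of_nonneg_left (ncard_norm_smul_intCast_le hh h1 hR) hB0
  · intro k hk
    rw [hf _ (by simpa using hk), mul_zero]

/-- Summation by parts against an oscillating sign: translating by `e` flips `χ`, so the shifted sum
is minus the original one. Each application trades `f` for a difference, which is smaller by a
factor of the step. -/
theorem tsum_mul_eq_neg_half_tsum_forwardDiff {G : Type*} [AddCommGroup G] {χ f : G → ℝ} {e : G}
    (hχ : ∀ k, χ (k + e) = -χ k) (hf : (Function.support f).Finite) :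
    ∑' k, χ k * f k = -(1 / 2) * ∑' k, χ k * forwardDiff e f k := by
  have hs1 : Summable fun k ↦ χ k * f k :=
    summable_of_hasFiniteSupport (hf.subset (Function.support_mul_subset_right _ _))
  have hs2 : Summable fun k ↦ χ k * f (k + e) := by
    have : Summable fun k ↦ χ (k + e) * f (k + e) :=
      (Equiv.addRight e).summable_iff.mpr hs1
    simpa [hχ] using this.neg
  have hshift : ∑' k, χ k * f (k + e) = -∑' k, χ k * f k := by
    rw [← (Equiv.addRight e).tsum_eq (fun k ↦ χ k * f k), ← tsum_neg]
    simp [hχ]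
  have : ∑' k, χ k * forwardDiff e f k = -2 * ∑' k, χ k * f k := by
    simp only [forwardDiff, mul_sub]
    rw [hs2.tsum_sub hs1, hshift]
    ring
  rw [this]; ring

theorem tsum_mul_smul_intCast_eq [DecidableEq ι] {f : (ι → ℝ) → ℝ} {R : ℝ}
    (hf : ∀ x, R < ‖x‖ → f x = 0) {χ : (ι → ℤ) → ℝ} {i : ι}
    (hχ : ∀ k, χ (k + Pi.single i 1) = -χ k) {h : ℝ} (hh : 0 < h) (h1 : h ≤ 1) (j : ℕ) :
    ∑' k : ι → ℤ, χ k * f (h • fun i ↦ (k i : ℝ)) =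
      (-(1 / 2)) ^ j * ∑' k : ι → ℤ, χ k *
        (forwardDiff (h • (Pi.single i 1 : ι → ℝ)))^[j] f (h • fun i ↦ (k i : ℝ)) := by
  have hv : ‖h • (Pi.single i 1 : ι → ℝ)‖ ≤ 1 := by
    rw [norm_smul, Pi.norm_single, norm_one, mul_one, Real.norm_eq_abs, abs_of_pos hh]
    exact h1
  induction j with
  | zero => simp
  | succ j ih =>
    rw [ih, tsum_mul_eq_neg_half_tsum_forwardDiff hχ
      (finite_support_smul_intCast (iterate_forwardDiff_eq_zero hf hv j) hh), pow_succ, mul_assoc]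
    congr 3
    ext k
    rw [Function.iterate_succ_apply']
    have hkv : (h • fun l ↦ (((k + Pi.single i 1 : ι → ℤ) l : ℤ) : ℝ)) =
        (h • fun l ↦ (k l : ℝ)) + h • (Pi.single i 1 : ι → ℝ) := by
      ext l
      by_cases hl : l = i
      · subst hl; simp; ring
      · simp [hl]
    simp only [forwardDiff, hkv]

/-- Detection of the even sublattice by sign characters: `∏ i, (1 + (-1) ^ k i)` is `2 ^ n` when all
coordinates are even and `0` otherwise. The term `E = ∅` is the full lattice sum; every other term
oscillates. -/
theorem tsum_smul_intCast_two_mul [DecidableEq ι] {f : (ι → ℝ) → ℝ} {R : ℝ}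
    (hf : ∀ x, R < ‖x‖ → f x = 0) {h : ℝ} (hh : 0 < h) :
    2 ^ Fintype.card ι * ∑' m : ι → ℤ, f ((2 * h) • fun i ↦ (m i : ℝ)) =
      ∑ E : Finset ι, ∑' k : ι → ℤ, (∏ i ∈ E, (-1 : ℝ) ^ (k i).natAbs) *
        f (h • fun i ↦ (k i : ℝ)) := by
  have hfin := finite_support_smul_intCast hf hh
  have hev : ∀ k : ι → ℤ, ∑ E : Finset ι, ∏ i ∈ E, (-1 : ℝ) ^ (k i).natAbs =
      if ∀ i, Even (k i) then 2 ^ Fintype.card ι else 0 := by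
    intro k
    have h1 := Finset.prod_one_add (f := fun i ↦ (-1 : ℝ) ^ (k i).natAbs) Finset.univ
    rw [Finset.powerset_univ] at h1
    rw [← h1]
    split_ifs with hk
    · rw [Finset.prod_congr rfl (g := fun _ ↦ (2 : ℝ))]
      · simp
      · intro i _
        rw [(Int.natAbs_even.mpr (hk i)).neg_one_pow]; norm_num
    · push Not at hk
      obtain ⟨i, hi⟩ := hk
      refine Finset.prod_eq_zero (Finset.mem_univ i) ?_
      rw [(Int.natAbs_odd.mpr (Int.not_even_iff_odd.mp hi)).neg_one_pow]; norm_num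
  rw [← Summable.tsum_finsetSum fun E _ ↦
    summable_of_hasFiniteSupport (hfin.subset (Function.support_mul_subset_right _ _))]
  simp_rw [← Finset.sum_mul, hev]
  have hinj : Function.Injective fun m : ι → ℤ ↦ fun i ↦ 2 * m i := fun a b hab ↦ by
    ext i
    have := congrFun hab i
    simpa using this
  rw [← tsum_mul_left, ← hinj.tsum_eq (f := fun k : ι → ℤ ↦
    (if ∀ i, Even (k i) then (2 : ℝ) ^ Fintype.card ι else 0) * f (h • fun i ↦ (k i : ℝ)))]
  · refine tsum_congr fun m ↦ ?_
    rw [if_pos (by simp)]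
    congr 2
    ext i
    simp only [Pi.smul_apply, smul_eq_mul]
    push_cast
    ring
  · intro k hk
    have hk' : ∀ i, Even (k i) := by
      by_contra hc
      simp [hc] at hk
    choose c hc using fun i ↦ (hk' i).two_dvd
    exact ⟨c, by ext i; simp [← hc]⟩

/-- Comparison of the smooth lattice sums with steps `h` and `2 * h`. -/
theorem exists_abs_two_pow_mul_tsum_sub_le [DecidableEq ι] {f : (ι → ℝ) → ℝ}
    (hf : ContDiff ℝ (⊤ : ℕ∞) f) (hs : HasCompactSupport f) :
    ∃ D, ∀ h : ℝ, 0 < h → h ≤ 1 →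
      |2 ^ Fintype.card ι * ∑' m : ι → ℤ, f ((2 * h) • fun i ↦ (m i : ℝ)) -
        ∑' m : ι → ℤ, f (h • fun i ↦ (m i : ℝ))| ≤ D := by
  obtain ⟨R, hR0, hR⟩ : ∃ R, 0 ≤ R ∧ ∀ x, R < ‖x‖ → f x = 0 := by
    obtain ⟨R, hR⟩ := hs.isCompact.isBounded.exists_norm_le
    refine ⟨max R 0, le_max_right _ _, fun x hx ↦ ?_⟩
    by_contra hc
    exact absurd (hR x (subset_tsupport _ hc)) (not_le.mpr ((le_max_left _ _).trans_lt hx))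
  set n := Fintype.card ι
  -- For `i ∈ E`, differencing `n` times in direction `i` gains `h ^ n`, which exactly cancels the
  -- `O(h ^ (-n))` lattice points in the support.
  have key : ∀ E : Finset ι, E ≠ ∅ → ∃ D, ∀ h : ℝ, 0 < h → h ≤ 1 →
      |∑' k : ι → ℤ, (∏ i ∈ E, (-1 : ℝ) ^ (k i).natAbs) * f (h • fun i ↦ (k i : ℝ))| ≤ D := by
    intro E hE
    obtain ⟨i, hi⟩ := Finset.nonempty_iff_ne_empty.mpr hE
    obtain ⟨M, hM⟩ := exists_abs_iterate_forwardDiff_le (Pi.single i 1 : ι → ℝ) n f hf hs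
    refine ⟨|(-(1 / 2) : ℝ) ^ n| * (M * (2 * (R + n) + 1) ^ n), fun h hh h1 ↦ ?_⟩
    have hsign : ∀ a : ℤ, (-1 : ℝ) ^ (a + 1).natAbs = -(-1 : ℝ) ^ a.natAbs := by
      intro a
      rcases Int.even_or_odd a with ha | ha
      · rw [(Int.natAbs_even.mpr ha).neg_one_pow, (Int.natAbs_odd.mpr ha.add_one).neg_one_pow]
      · rw [(Int.natAbs_odd.mpr ha).neg_one_pow, (Int.natAbs_even.mpr ha.add_one).neg_one_pow,
          neg_neg]
    have hχ : ∀ k : ι → ℤ, ∏ l ∈ E, (-1 : ℝ) ^ ((k + Pi.single i 1 : ι → ℤ) l).natAbs =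
        -∏ l ∈ E, (-1 : ℝ) ^ (k l).natAbs := by
      intro k
      rw [← Finset.mul_prod_erase _ _ hi, ← Finset.mul_prod_erase E _ hi, ← neg_mul]
      congr 1
      · simpa using hsign (k i)
      · refine Finset.prod_congr rfl fun l hl ↦ ?_
        simp [(Finset.mem_erase.mp hl).1]
    have hv : ‖h • (Pi.single i 1 : ι → ℝ)‖ ≤ 1 := by
      rw [norm_smul, Pi.norm_single, norm_one, mul_one, Real.norm_eq_abs, abs_of_pos hh]
      exact h1
    rw [tsum_mul_smul_intCast_eq hR hχ hh h1 n, abs_mul]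
    refine mul_le_mul_of_nonneg_left ?_ (abs_nonneg _)
    refine (abs_tsum_mul_smul_intCast_le (by positivity : (0 : ℝ) ≤ R + n)
      (iterate_forwardDiff_eq_zero hR hv n) (hM h hh.le)
      (fun k ↦ by simp [Finset.abs_prod]) hh h1).trans_eq ?_
    rw [div_pow]
    change M * h ^ n * ((2 * (R + n) + 1) ^ n / h ^ n) = M * (2 * (R + n) + 1) ^ n
    field_simp
  choose! D hD using key
  refine ⟨∑ E ∈ Finset.univ.erase ∅, D E, fun h hh h1 ↦ ?_⟩
  rw [tsum_smul_intCast_two_mul hR hh, ← Finset.add_sum_erase _ _ (Finset.mem_univ ∅)]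
  simp only [Finset.prod_empty, one_mul, add_sub_cancel_left]
  exact (Finset.abs_sum_le_sum_abs _ _).trans
    (Finset.sum_le_sum fun E hE ↦ hD E (Finset.mem_erase.mp hE).1 h hh h1)

/-- Riemann sums of a continuous compactly supported function along the steps `t / 2 ^ k`. -/
theorem tendsto_pow_mul_tsum_smul_intCast {f : (ι → ℝ) → ℝ} (hf : Continuous f) {R : ℝ}
    (hR : ∀ x, R < ‖x‖ → f x = 0) {t : ℝ} (ht : 0 < t) :
    Tendsto (fun k : ℕ ↦ (t / 2 ^ k) ^ Fintype.card ι *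
      ∑' m : ι → ℤ, f ((t / 2 ^ k) • fun i ↦ (m i : ℝ))) atTop
      (nhds (∫ x, f x)) := by
  classical
  -- Absorbing `t` into the function leaves Riemann sums over `(1 / N) • ℤ^ι`, taken along `N = 2 ^
  -- k`.
  have hft : Continuous fun x : ι → ℝ ↦ f (t • x) := hf.comp (continuous_const_smul t)
  set s : Set (ι → ℝ) := Metric.closedBall 0 (R / t)
  have hout : ∀ x, x ∉ s → f (t • x) = 0 := fun x hx ↦ hR _ <| by
    rw [norm_smul, Real.norm_eq_abs, abs_of_pos ht, mul_comm, ← div_lt_iff₀ ht]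
    simpa [s] using hx
  have h0 := (tendsto_tsum_div_pow_atTop_integral s (fun x ↦ f (t • x)) hft
    Metric.isBounded_closedBall Metric.isClosed_closedBall.measurableSet
    ((convex_closedBall _ _).addHaar_frontier _)).comp
    (tendsto_pow_atTop_atTop_of_one_lt (one_lt_two (α := ℕ)))
  have hint : ∫ x in s, f (t • x) = (t ^ Fintype.card ι)⁻¹ * ∫ x, f x := by
    rw [MeasureTheory.setIntegral_eq_integral_of_forall_compl_eq_zero hout,
      MeasureTheory.Measure.integral_comp_smul]
    rw [Module.finrank_fintype_fun_eq_card, abs_of_pos (by positivity), smul_eq_mul]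
  rw [hint] at h0
  have h1 := h0.const_mul (t ^ Fintype.card ι)
  rw [mul_inv_cancel_left₀ (by positivity)] at h1
  refine h1.congr fun k ↦ ?_
  simp only [Function.comp_apply]
  have hN : (0 : ℝ) < ((2 ^ k : ℕ) : ℝ) := by positivity
  rw [tsum_subtype (s ∩ ((2 ^ k : ℕ) : ℝ)⁻¹ •
    (Submodule.span ℤ (Set.range (Pi.basisFun ℝ ι)) : Set (ι → ℝ))) (fun x ↦ f (t • x))]
  have hinj : Function.Injective fun m : ι → ℤ ↦
      (((2 ^ k : ℕ) : ℝ)⁻¹ • fun i ↦ (m i : ℝ) : ι → ℝ) := by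
    intro a b hab
    have := smul_right_injective (ι → ℝ) (inv_ne_zero hN.ne') hab
    ext i
    exact_mod_cast congrFun this i
  have hmem : ∀ x : ι → ℝ, x ∈ (Submodule.span ℤ (Set.range (Pi.basisFun ℝ ι)) : Set (ι → ℝ)) ↔
      ∃ m : ι → ℤ, (fun i ↦ (m i : ℝ)) = x := by
    intro x
    rw [SetLike.mem_coe, (Pi.basisFun ℝ ι).mem_span_iff_repr_mem ℤ]
    simp only [Pi.basisFun_repr, Set.mem_range, algebraMap_int_eq, Int.coe_castRingHom]
    constructor
    · intro h
      choose m hm using h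
      exact ⟨m, funext hm⟩
    · rintro ⟨m, rfl⟩ i
      exact ⟨m i, rfl⟩
  rw [← hinj.tsum_eq]
  · rw [div_pow, mul_div_assoc', mul_comm, ← mul_div_assoc', mul_comm]
    push_cast
    congr 1
    refine tsum_congr fun m ↦ ?_
    rw [Set.indicator_apply]
    split_ifs with hc
    · rw [smul_smul, div_eq_mul_inv]
    · symm
      rw [div_eq_mul_inv, ← smul_smul]
      refine hout _ fun hmem' ↦ hc ⟨hmem', ?_⟩
      exact Set.smul_mem_smul_set ((hmem _).mpr ⟨m, rfl⟩)
  · intro x hx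
    obtain ⟨-, hx2⟩ := Set.mem_of_indicator_ne_zero hx
    obtain ⟨y, hy, rfl⟩ := hx2
    obtain ⟨m, rfl⟩ := (hmem y).mp hy
    exact ⟨m, rfl⟩

/-- A smooth compactly supported sum over `t • ℤ^ι` equals its main term `t ^ (-n) * ∫ f` up to a
bounded error. -/
theorem exists_abs_tsum_smul_intCast_sub_le [Nonempty ι] {f : (ι → ℝ) → ℝ}
    (hf : ContDiff ℝ (⊤ : ℕ∞) f) (hs : HasCompactSupport f) :
    ∃ C D, ∀ t : ℝ, 0 < t → t ≤ 1 →
      |∑' m : ι → ℤ, f (t • fun i ↦ (m i : ℝ)) - C / t ^ Fintype.card ι| ≤ D := by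
  classical
  obtain ⟨R, hR⟩ : ∃ R, ∀ x, R < ‖x‖ → f x = 0 := by
    obtain ⟨R, hR⟩ := hs.isCompact.isBounded.exists_norm_le
    refine ⟨R, fun x hx ↦ ?_⟩
    by_contra hc
    exact absurd (hR x (subset_tsupport _ hc)) (not_le.mpr hx)
  obtain ⟨D, hD⟩ := exists_abs_two_pow_mul_tsum_sub_le hf hs
  have hD0 : 0 ≤ D := (abs_nonneg _).trans (hD 1 one_pos le_rfl)
  refine ⟨∫ x, f x, D, fun t ht h1 ↦ ?_⟩
  set n := Fintype.card ι
  have hn : n ≠ 0 := Fintype.card_ne_zero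
  have hlim := tendsto_pow_mul_tsum_smul_intCast hf.continuous hR ht
  -- The normalised sums with steps `t / 2 ^ k` start at the sum wanted, tend to the integral, and
  -- have consecutive differences at most `D * t ^ n / 2 ^ (k + 1)`; here `n ≥ 1` is essential. The
  -- geometric series adds up to `D * t ^ n`.
  have hstep := dist_le_of_le_geometric_two_of_tendsto₀ (C := D * t ^ n) (fun k ↦ ?_) hlim
  · rw [Real.dist_eq] at hstep
    simp only [pow_zero, div_one] at hstep
    have htn : 0 < t ^ n := by positivity
    rw [← mul_le_mul_iff_left₀ htn, ← abs_of_pos htn, ← abs_mul, sub_mul, abs_of_pos htn,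
      div_mul_cancel₀ _ htn.ne', mul_comm]
    exact hstep
  · rw [Real.dist_eq]
    set h := t / 2 ^ (k + 1) with hh
    have h2 : t / 2 ^ k = 2 * h := by rw [hh, pow_succ]; field_simp
    have hpos : 0 < h := by positivity
    have hle : h ≤ t / 2 ^ (k + 1) := le_rfl
    have hh1 : h ≤ 1 := (div_le_self ht.le (one_le_pow₀ one_le_two)).trans h1
    rw [h2, mul_pow]
    have e : ∀ a b : ℝ, 2 ^ n * h ^ n * a - h ^ n * b = h ^ n * (2 ^ n * a - b) := by intros; ring
    rw [e, abs_mul, abs_of_pos (by positivity : 0 < h ^ n)]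
    have h3 : h ^ n ≤ t ^ n / 2 ^ (k + 1) := by
      rw [hh, div_pow]
      gcongr
      exact le_self_pow₀ (one_le_pow₀ one_le_two) hn
    calc h ^ n * _ ≤ t ^ n / 2 ^ (k + 1) * D :=
          mul_le_mul h3 (hD h hpos hh1) (abs_nonneg _) (by positivity)
      _ = D * t ^ n / 2 / 2 ^ k := by rw [pow_succ]; field_simp

end IntegerLattice

/-! ### A smooth partition of unity for the action of the units on the mixed space -/

/-- A smooth function supported on `[-1, 1]` whose integer translates sum to `1`. -/
noncomputable def unitBump (c : ℝ) : ℝ := Real.smoothTransition (c + 1) - Real.smoothTransition c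

theorem contDiff_unitBump : ContDiff ℝ (⊤ : ℕ∞) unitBump :=
  (Real.smoothTransition.contDiff.comp (contDiff_id.add contDiff_const)).sub
    Real.smoothTransition.contDiff

theorem abs_lt_one_of_unitBump_ne_zero {c : ℝ} (hc : unitBump c ≠ 0) : |c| < 1 := by
  contrapose! hc
  rw [unitBump, sub_eq_zero]
  rcases le_abs.mp hc with h | h
  · rw [Real.smoothTransition.one_of_one_le h, Real.smoothTransition.one_of_one_le (by linarith)]
  · rw [Real.smoothTransition.zero_of_nonpos (by linarith),
      Real.smoothTransition.zero_of_nonpos (by linarith)]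

theorem unitBump_add_intCast_eq_zero {c : ℝ} {m : ℤ} (hm : m ∉ ({⌊-c⌋, ⌊-c⌋ + 1} : Finset ℤ)) :
    unitBump (c + m) = 0 := by
  contrapose! hm
  have h1 := abs_lt.mp (abs_lt_one_of_unitBump_ne_zero hm)
  have h2 := Int.floor_le (-c)
  have h3 := Int.lt_floor_add_one (-c)
  have h4 : ⌊-c⌋ - 1 < m := by exact_mod_cast (by linarith : ((⌊-c⌋ : ℝ) - 1) < m)
  have h5 : m < ⌊-c⌋ + 2 := by exact_mod_cast (by linarith : (m : ℝ) < (⌊-c⌋ : ℝ) + 2)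
  simp only [Finset.mem_insert, Finset.mem_singleton]
  omega

/-- The two surviving translates telescope to the smooth transition at a point `≥ 1` minus its value
at a point `≤ 0`. -/
theorem sum_unitBump_add_intCast (c : ℝ) :
    ∑ m ∈ ({⌊-c⌋, ⌊-c⌋ + 1} : Finset ℤ), unitBump (c + m) = 1 := by
  have h2 := Int.floor_le (-c)
  have h3 := Int.lt_floor_add_one (-c)
  rw [Finset.sum_pair (by simp), unitBump, unitBump]
  push_cast
  rw [Real.smoothTransition.zero_of_nonpos (x := c + ⌊-c⌋) (by linarith),
    Real.smoothTransition.one_of_one_le (x := c + (⌊-c⌋ + 1) + 1) (by linarith), ← add_assoc]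
  ring

theorem hasSum_prod_unitBump_add_intCast {r : Type*} [Fintype r] (c : r → ℝ) :
    HasSum (fun m : r → ℤ ↦ ∏ i, unitBump (c i + m i)) 1 := by
  classical
  have h1 : ∑ m ∈ Fintype.piFinset fun i ↦ ({⌊-c i⌋, ⌊-c i⌋ + 1} : Finset ℤ),
      ∏ i, unitBump (c i + m i) = 1 := by
    rw [← Finset.prod_univ_sum (fun i ↦ ({⌊-c i⌋, ⌊-c i⌋ + 1} : Finset ℤ))
      (fun i m ↦ unitBump (c i + m))]
    exact Finset.prod_eq_one fun i _ ↦ sum_unitBump_add_intCast (c i)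
  rw [← h1]
  refine hasSum_sum_of_ne_finset_zero fun m hm ↦ ?_
  rw [Fintype.mem_piFinset] at hm
  push Not at hm
  obtain ⟨i, hi⟩ := hm
  exact Finset.prod_eq_zero (Finset.mem_univ i) (unitBump_add_intCast_eq_zero hi)

theorem hasSum_comp_snd {α β : Type*} [Finite α] {f : β → ℝ} {a : ℝ} (h : HasSum f a) :
    HasSum (fun p : α × β ↦ f p.2) (Nat.card α * a) := by
  have := Fintype.ofFinite α
  have h1 := hasSum_fintype fun _ : α ↦ (1 : ℝ)
  have h2 := h1.mul h (summable_mul_of_summable_norm (f := fun _ : α ↦ (1 : ℝ))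
    h1.summable.norm h.summable.norm)
  simpa using h2

namespace NumberField.mixedEmbedding

open NumberField.Units NumberField.Units.dirichletUnitTheorem NumberField.InfinitePlace Module

open scoped Classical

variable (K : Type*) [Field K] [NumberField K]

/-- The basis of the logarithmic space attached to a system of fundamental units. -/
noncomputable def logSpaceBasis : Basis (Fin (rank K)) ℝ (logSpace K) :=
  (basisUnitLattice K).ofZLatticeBasis ℝ _

/-- Every unit is uniquely a root of unity times a product of powers of fundamental units. -/
noncomputable def torsionProdEquivUnits : torsion K × (Fin (rank K) → ℤ) ≃ (𝓞 K)ˣ :=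
  Equiv.ofBijective (fun ζe ↦ ζe.1 * ∏ i, fundSystem K i ^ ζe.2 i)
    ⟨fun a b hab ↦ (exist_unique_eq_mul_prod K _).unique rfl hab, fun x ↦ by
      obtain ⟨ζe, h, -⟩ := exist_unique_eq_mul_prod K x
      exact ⟨ζe, h.symm⟩⟩

variable {K}

theorem torsionProdEquivUnits_apply (ζ : torsion K) (e : Fin (rank K) → ℤ) :
    torsionProdEquivUnits K (ζ, e) = ζ * ∏ i, fundSystem K i ^ e i := rfl

theorem logEmbedding_torsionProdEquivUnits (ζ : torsion K) (e : Fin (rank K) → ℤ) :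
    logEmbedding K (Additive.ofMul (torsionProdEquivUnits K (ζ, e))) =
      ∑ i, (e i : ℝ) • logSpaceBasis K i := by
  have h0 : logEmbedding K (Additive.ofMul (ζ : (𝓞 K)ˣ)) = 0 := logEmbedding_eq_zero_iff.mpr ζ.2
  simp only [torsionProdEquivUnits_apply, ofMul_mul, map_add, h0, zero_add,
    ofMul_prod, map_sum, ofMul_zpow, map_zsmul, logEmbedding_fundSystem, logSpaceBasis,
    Basis.ofZLatticeBasis_apply]
  exact Finset.sum_congr rfl fun i _ ↦ (Int.cast_smul_eq_zsmul ℝ _ _).symm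

/-- In these coordinates units act by integer translations, which is what lets integer translates of
`unitBump` serve as a partition of unity for the unit action. -/
theorem logSpaceBasis_repr_unit_smul (ζ : torsion K) (e : Fin (rank K) → ℤ) {x : mixedSpace K}
    (hx : mixedEmbedding.norm x ≠ 0) (i : Fin (rank K)) :
    (logSpaceBasis K).repr (logMap (torsionProdEquivUnits K (ζ, e) • x)) i =
      (logSpaceBasis K).repr (logMap x) i + e i := by
  rw [logMap_unit_smul _ hx, logEmbedding_torsionProdEquivUnits, map_add, Finsupp.add_apply,
    add_comm]
  congr 1
  rw [(logSpaceBasis K).repr_sum_self fun i ↦ (e i : ℝ)]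

/-- A function on the mixed space whose sum over the orbit of `x` under the units is
`g (norm x)` times the number of roots of unity. -/
noncomputable def normBump (g : ℝ → ℝ) (x : mixedSpace K) : ℝ :=
  g (mixedEmbedding.norm x) * ∏ i, unitBump ((logSpaceBasis K).repr (logMap x) i)

/-- The norm is constant on the orbit. The exponents of the fundamental units contribute the sum `1`
of the partition of unity, and the roots of unity, acting trivially on both factors, contribute
their number. -/
theorem hasSum_normBump_unit_smul (g : ℝ → ℝ) {x : mixedSpace K}
    (hx : mixedEmbedding.norm x ≠ 0) :
    HasSum (fun u : (𝓞 K)ˣ ↦ normBump g (u • x)) (torsionOrder K * g (mixedEmbedding.norm x)) := by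
  have h1 := hasSum_prod_unitBump_add_intCast fun i ↦ (logSpaceBasis K).repr (logMap x) i
  rw [← (torsionProdEquivUnits K).hasSum_iff]
  have h2 : ((fun u : (𝓞 K)ˣ ↦ normBump g (u • x)) ∘ torsionProdEquivUnits K) =
      fun p : torsion K × (Fin (rank K) → ℤ) ↦ (g (mixedEmbedding.norm x) : ℝ) *
        ∏ i, unitBump ((logSpaceBasis K).repr (logMap x) i + p.2 i) := by
    ext ⟨ζ, e⟩
    simp only [Function.comp_apply, normBump, norm_unit_smul, logSpaceBasis_repr_unit_smul _ _ hx]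
  rw [h2, torsionOrder]
  simpa using hasSum_comp_snd (α := torsion K) (h1.mul_left (g (mixedEmbedding.norm x)))

theorem contDiffAt_normAtPlace {w : InfinitePlace K} {x : mixedSpace K}
    (hx : normAtPlace w x ≠ 0) : ContDiffAt ℝ (⊤ : ℕ∞) (normAtPlace w) x := by
  by_cases hw : IsReal w
  · rw [funext (normAtPlace_apply_of_isReal hw)]
    rw [normAtPlace_apply_of_isReal hw] at hx
    refine ContDiffAt.norm ℝ ?_ (norm_ne_zero_iff.mp hx)
    exact ((contDiff_apply ℝ ℝ _).comp contDiff_fst).contDiffAt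
  · rw [not_isReal_iff_isComplex] at hw
    rw [funext (normAtPlace_apply_of_isComplex hw)]
    rw [normAtPlace_apply_of_isComplex hw] at hx
    refine ContDiffAt.norm ℝ ?_ (norm_ne_zero_iff.mp hx)
    exact ((contDiff_apply ℝ ℂ _).comp contDiff_snd).contDiffAt

theorem contDiffAt_norm {x : mixedSpace K} (hx : mixedEmbedding.norm x ≠ 0) :
    ContDiffAt ℝ (⊤ : ℕ∞) (mixedEmbedding.norm : mixedSpace K → ℝ) x := by
  have : (mixedEmbedding.norm : mixedSpace K → ℝ) = fun x ↦ ∏ w, normAtPlace w x ^ mult w := by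
    ext x; exact mixedEmbedding.norm_apply x
  rw [this]
  exact contDiffAt_prod fun w _ ↦
    (contDiffAt_normAtPlace (mixedEmbedding.norm_ne_zero_iff.mp hx w)).pow _

theorem contDiffAt_logMap {x : mixedSpace K} (hx : mixedEmbedding.norm x ≠ 0) :
    ContDiffAt ℝ (⊤ : ℕ∞) (logMap : mixedSpace K → logSpace K) x := by
  refine contDiffAt_pi.mpr fun w ↦ ?_
  have hw := mixedEmbedding.norm_ne_zero_iff.mp hx w.1
  exact contDiffAt_const.mul (((contDiffAt_normAtPlace hw).log hw).sub
    (((contDiffAt_norm hx).log hx).mul contDiffAt_const))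

/-- The logarithms are singular only where the norm vanishes, and near such points `g` of the norm
is identically `0`. -/
theorem contDiff_normBump {g : ℝ → ℝ} (hg : ContDiff ℝ (⊤ : ℕ∞) g)
    (h0 : tsupport g ⊆ Set.Ioi 0) : ContDiff ℝ (⊤ : ℕ∞) (normBump (K := K) g) := by
  refine contDiff_iff_contDiffAt.mpr fun x ↦ ?_
  by_cases hx : mixedEmbedding.norm x = 0
  · have hev : ∀ᶠ y in nhds x, normBump g y = 0 := by
      have h1 : g =ᶠ[nhds (mixedEmbedding.norm x)] 0 := by
        rw [← notMem_tsupport_iff_eventuallyEq, hx]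
        exact fun h ↦ lt_irrefl (0 : ℝ) (h0 h)
      filter_upwards [((mixedEmbedding.continuous_norm K).tendsto x).eventually h1] with y hy
      rw [normBump, hy]
      simp
    exact contDiffAt_const.congr_of_eventuallyEq hev
  · refine (hg.contDiffAt.comp x (contDiffAt_norm hx)).mul (contDiffAt_prod fun i _ ↦ ?_)
    refine contDiff_unitBump.contDiffAt.comp x ?_
    exact ((LinearMap.toContinuousLinearMap ((logSpaceBasis K).coord i)).contDiff.contDiffAt).comp x
      (contDiffAt_logMap hx)

/-- On the support the logarithm of the norm and the logarithmic coordinates are bounded. This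
bounds the absolute value at every place except `w₀`; the one at `w₀` is recovered from the product
formula for the norm. -/
theorem hasCompactSupport_normBump {g : ℝ → ℝ} (hs : HasCompactSupport g)
    (h0 : tsupport g ⊆ Set.Ioi 0) : HasCompactSupport (normBump (K := K) g) := by
  obtain ⟨L, hL⟩ : ∃ L, ∀ t ∈ tsupport g, |Real.log t| ≤ L := by
    obtain ⟨L, hL⟩ := IsCompact.exists_bound_of_continuousOn hs.isCompact
      (Real.continuousOn_log.mono fun t ht ↦ (h0 ht : (0 : ℝ) < t).ne')
    exact ⟨L, hL⟩
  set Q : ℝ := ∑ i, ‖logSpaceBasis K i‖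
  set P : ℝ := (Fintype.card (InfinitePlace K) : ℝ)
  have hQ0 : 0 ≤ Q := Finset.sum_nonneg fun _ _ ↦ norm_nonneg _
  refine HasCompactSupport.of_support_subset_isCompact
    (isCompact_closedBall (0 : mixedSpace K) (Real.exp (L + P * (Q + 2 * L) + Q))) fun x hx ↦ ?_
  have hx' : normBump g x ≠ 0 := hx
  have hg0 : g (mixedEmbedding.norm x) ≠ 0 := left_ne_zero_of_mul hx'
  have hmem := subset_tsupport g hg0
  have hnorm : 0 < mixedEmbedding.norm x := h0 hmem
  have hlog := hL _ hmem
  have hL0 : 0 ≤ L := (abs_nonneg _).trans hlog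
  have hpos : ∀ w, 0 < normAtPlace w x := fun w ↦
    (normAtPlace_nonneg w x).lt_of_ne (mixedEmbedding.norm_ne_zero_iff.mp hnorm.ne' w).symm
  have hmap : ‖logMap x‖ ≤ Q := by
    rw [← (logSpaceBasis K).sum_repr (logMap x)]
    refine (norm_sum_le _ _).trans (Finset.sum_le_sum fun i _ ↦ ?_)
    rw [_root_.norm_smul]
    refine mul_le_of_le_one_left (norm_nonneg _) (abs_lt_one_of_unitBump_ne_zero ?_).le
    exact Finset.prod_ne_zero_iff.mp (right_ne_zero_of_mul hx') i (Finset.mem_univ i)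
  have hn1 : (1 : ℝ) ≤ finrank ℚ K := by exact_mod_cast finrank_pos
  have hmult : ∀ w : InfinitePlace K, (1 : ℝ) ≤ mult w ∧ (mult w : ℝ) ≤ 2 := fun w ↦ by
    unfold mult; split_ifs <;> norm_num
  set ℓ := Real.log (mixedEmbedding.norm x) * (finrank ℚ K : ℝ)⁻¹
  have hℓ : |ℓ| ≤ L := by
    rw [abs_mul, abs_inv, Nat.abs_cast, ← div_eq_mul_inv]
    exact (div_le_self (abs_nonneg _) hn1).trans hlog
  have hw : ∀ w : InfinitePlace K, w ≠ w₀ →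
      |mult w * (Real.log (normAtPlace w x) - ℓ)| ≤ Q := fun w hw ↦
    ((norm_le_pi_norm (logMap x) ⟨w, hw⟩).trans hmap)
  have hw' : ∀ w : InfinitePlace K, w ≠ w₀ →
      |mult w * Real.log (normAtPlace w x)| ≤ Q + 2 * L := fun w h ↦ by
    have h1 := hw w h
    have h2 : |(mult w : ℝ) * ℓ| ≤ 2 * L := by
      rw [abs_mul, Nat.abs_cast]
      exact mul_le_mul (hmult w).2 hℓ (abs_nonneg _) zero_le_two
    calc |mult w * Real.log (normAtPlace w x)|
        = |mult w * (Real.log (normAtPlace w x) - ℓ) + mult w * ℓ| := by ring_nf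
      _ ≤ _ := (abs_add_le _ _).trans (add_le_add h1 h2)
  have hbound : ∀ w : InfinitePlace K,
      |mult w * Real.log (normAtPlace w x)| ≤ L + P * (Q + 2 * L) + Q := by
    intro w
    have hP : (1 : ℝ) ≤ P := by
      exact Nat.one_le_cast.mpr Fintype.card_pos
    by_cases h : w = w₀
    · subst h
      have hsum : Real.log (mixedEmbedding.norm x) = ∑ w, mult w * Real.log (normAtPlace w x) := by
        rw [mixedEmbedding.norm_apply, Real.log_prod fun w _ ↦ pow_ne_zero _ (hpos w).ne']
        simp [Real.log_pow]
      rw [← Finset.add_sum_erase _ _ (Finset.mem_univ (w₀ : InfinitePlace K))] at hsum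
      have h2 : |∑ w ∈ Finset.univ.erase (w₀ : InfinitePlace K),
          mult w * Real.log (normAtPlace w x)| ≤ P * (Q + 2 * L) := by
        refine (Finset.abs_sum_le_sum_abs _ _).trans ((Finset.sum_le_card_nsmul _ _ (Q + 2 * L)
          fun w h ↦ hw' w (Finset.mem_erase.mp h).1).trans ?_)
        rw [nsmul_eq_mul]
        refine mul_le_mul_of_nonneg_right ?_ (by positivity)
        exact Nat.cast_le.mpr (Finset.card_le_univ _)
      rw [eq_sub_of_add_eq hsum.symm]
      refine (abs_sub _ _).trans ?_
      linarith
    · refine (hw' w h).trans ?_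
      nlinarith
  rw [mem_closedBall_zero_iff, norm_eq_sup'_normAtPlace]
  refine Finset.sup'_le _ _ fun w _ ↦ ?_
  rw [← Real.log_le_iff_le_exp (hpos w)]
  refine (le_abs_self _).trans (le_trans ?_ (hbound w))
  rw [abs_mul, Nat.abs_cast]
  exact le_mul_of_one_le_left (abs_nonneg _) (hmult w).1

end NumberField.mixedEmbedding

/-! ### Smooth sums over the lattice spanned by a basis -/

section BasisLattice

variable {E ι : Type*} [NormedAddCommGroup E] [NormedSpace ℝ E] [Fintype ι]

theorem tsum_span_basis_eq (b : Module.Basis ι ℝ E) (φ : E → ℝ) (t : ℝ) :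
    ∑' x : Submodule.span ℤ (Set.range b), φ (t • (x : E)) =
      ∑' m : ι → ℤ, φ (b.equivFun.symm (t • fun i ↦ (m i : ℝ))) := by
  rw [← (b.restrictScalars ℤ).equivFun.symm.toEquiv.tsum_eq]
  refine tsum_congr fun m ↦ ?_
  congr 1
  rw [map_smul]
  congr 1
  simp [Module.Basis.equivFun_symm_apply, Int.cast_smul_eq_zsmul ℝ]

theorem hasFiniteSupport_span_basis (b : Module.Basis ι ℝ E) {φ : E → ℝ}
    (hs : HasCompactSupport φ) {t : ℝ} (ht : 0 < t) :
    Summable fun x : Submodule.span ℤ (Set.range b) ↦ φ (t • (x : E)) := by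
  have := Module.Basis.finiteDimensional_of_finite b
  have hs' : HasCompactSupport (φ ∘ b.equivFun.symm) :=
    hs.comp_homeomorph b.equivFun.symm.toContinuousLinearEquiv.toHomeomorph
  obtain ⟨R, hR⟩ : ∃ R, ∀ x, R < ‖x‖ → (φ ∘ b.equivFun.symm) x = 0 := by
    obtain ⟨R, hR⟩ := hs'.isCompact.isBounded.exists_norm_le
    refine ⟨R, fun x hx ↦ ?_⟩
    by_contra hc
    exact absurd (hR x (subset_tsupport _ hc)) (not_le.mpr hx)
  have h1 : Summable fun m : ι → ℤ ↦ (φ ∘ b.equivFun.symm) (t • fun i ↦ (m i : ℝ)) :=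
    summable_of_hasFiniteSupport (finite_support_smul_intCast hR ht)
  rw [← (b.restrictScalars ℤ).equivFun.symm.toEquiv.summable_iff]
  refine h1.congr fun m ↦ ?_
  simp only [Function.comp_apply, map_smul]
  congr 2
  simp [Module.Basis.equivFun_symm_apply, Int.cast_smul_eq_zsmul ℝ]

/-- Smooth sums over the scalings of the lattice spanned by a basis. -/
theorem exists_abs_tsum_span_basis_sub_le [Nonempty ι] (b : Module.Basis ι ℝ E) {φ : E → ℝ}
    (hφ : ContDiff ℝ (⊤ : ℕ∞) φ) (hs : HasCompactSupport φ) :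
    ∃ C D, ∀ t : ℝ, 0 < t → t ≤ 1 →
      |∑' x : Submodule.span ℤ (Set.range b), φ (t • (x : E)) - C / t ^ Fintype.card ι| ≤ D := by
  have := Module.Basis.finiteDimensional_of_finite b
  have hs' : HasCompactSupport (φ ∘ b.equivFun.symm) :=
    hs.comp_homeomorph b.equivFun.symm.toContinuousLinearEquiv.toHomeomorph
  have hc' : ContDiff ℝ (⊤ : ℕ∞) (φ ∘ b.equivFun.symm) :=
    hφ.comp b.equivFun.symm.toContinuousLinearEquiv.contDiff
  obtain ⟨C, D, h⟩ := exists_abs_tsum_smul_intCast_sub_le hc' hs'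
  refine ⟨C, D, fun t ht h1 ↦ ?_⟩
  rw [tsum_span_basis_eq]
  exact h t ht h1

end BasisLattice

/-! ### Ideals in a fixed class as unit orbits in an ideal lattice -/

namespace NumberField.mixedEmbedding

open NumberField.Units NumberField.Units.dirichletUnitTheorem NumberField.InfinitePlace Module

open scoped Classical

variable {K : Type*} [Field K] [NumberField K]

theorem norm_mixedEmbedding_eq_absNorm_span (a : 𝓞 K) :
    mixedEmbedding.norm (mixedEmbedding K a) = (Ideal.absNorm (Ideal.span {a}) : ℝ) := by
  rw [Ideal.absNorm_span_singleton, Nat.cast_natAbs, ← Rat.cast_intCast, Int.cast_abs,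
    Algebra.coe_norm_int, norm_eq_norm]

/-- Multiplication by `J` makes every ideal in the class of `J⁻¹` principal; the generator,
determined up to units, lies in `J`. -/
theorem exists_span_singleton_eq_mul {J I : (Ideal (𝓞 K))⁰}
    (h : ClassGroup.mk0 I = (ClassGroup.mk0 J)⁻¹) :
    ∃ a : 𝓞 K, Ideal.span {a} = (I : Ideal (𝓞 K)) * J := by
  have h1 : ClassGroup.mk0 (I * J) = 1 := by rw [map_mul, h, inv_mul_cancel]
  obtain ⟨a, ha⟩ := ((ClassGroup.mk0_eq_one_iff (I * J).2).mp h1).principal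
  exact ⟨a, ha.symm⟩

theorem mem_span_idealLatticeBasis_mk0 (J : (Ideal (𝓞 K))⁰) (x : mixedSpace K) :
    x ∈ Submodule.span ℤ (Set.range (fractionalIdealLatticeBasis K (FractionalIdeal.mk0 K J))) ↔
      ∃ a ∈ (J : Ideal (𝓞 K)), mixedEmbedding K (a : K) = x := by
  rw [mem_span_fractionalIdealLatticeBasis]
  simp

section UnitOrbits

variable {J : (Ideal (𝓞 K))⁰}
  {γ : {I : (Ideal (𝓞 K))⁰ // ClassGroup.mk0 I = (ClassGroup.mk0 J)⁻¹} → 𝓞 K}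

theorem generator_ne_zero (hγ : ∀ I, Ideal.span {γ I} = (I.1.1 : Ideal (𝓞 K)) * J) (I) :
    γ I ≠ 0 := by
  intro h
  have h1 := hγ I
  rw [h, Ideal.span_singleton_zero] at h1
  exact nonZeroDivisors.coe_ne_zero (I.1 * J) (by simpa using h1.symm)

theorem generator_mem (hγ : ∀ I, Ideal.span {γ I} = (I.1.1 : Ideal (𝓞 K)) * J) (I) :
    γ I ∈ J.1 := by
  rw [← Ideal.span_singleton_le_iff_mem, hγ]
  exact Ideal.mul_le_right

theorem unit_smul_generator (I) (u : (𝓞 K)ˣ) :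
    u • mixedEmbedding K (γ I : K) = mixedEmbedding K ((u * γ I : 𝓞 K) : K) := by
  simp [unitSMul_smul]

/-- Together with `exists_unit_smul_generator_eq`, this splits the nonzero elements of `J` into
disjoint free unit orbits, one for each ideal in the class. -/
theorem injective_unit_smul_generator (hγ : ∀ I, Ideal.span {γ I} = (I.1.1 : Ideal (𝓞 K)) * J) :
    Function.Injective fun p : _ × (𝓞 K)ˣ ↦ p.2 • mixedEmbedding K (γ p.1 : K) := by
  rintro ⟨I, u⟩ ⟨I', u'⟩ h
  simp only [unit_smul_generator] at h
  have h1 : (u * γ I : 𝓞 K) = u' * γ I' :=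
    RingOfIntegers.coe_injective (mixedEmbedding_injective K h)
  have h2 : Ideal.span {γ I} = Ideal.span {γ I'} := by
    rw [← Ideal.span_singleton_mul_left_unit u.isUnit (γ I), h1,
      Ideal.span_singleton_mul_left_unit u'.isUnit]
  rw [hγ, hγ] at h2
  have h3 : I = I' := by
    apply Subtype.ext
    apply Subtype.ext
    exact mul_right_cancel₀ (nonZeroDivisors.coe_ne_zero J) h2
  subst h3
  rw [Prod.mk.injEq]
  exact ⟨rfl, Units.ext (mul_right_cancel₀ (generator_ne_zero hγ I) h1)⟩

theorem exists_unit_smul_generator_eq (hγ : ∀ I, Ideal.span {γ I} = (I.1.1 : Ideal (𝓞 K)) * J)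
    {a : 𝓞 K} (haJ : a ∈ (J : Ideal (𝓞 K))) (ha : a ≠ 0) :
    ∃ I, ∃ u : (𝓞 K)ˣ, u • mixedEmbedding K (γ I : K) = mixedEmbedding K (a : K) := by
  obtain ⟨I, hI⟩ := Ideal.dvd_span_singleton.mpr haJ
  have hI0 : I ≠ 0 := by
    rintro rfl
    rw [mul_zero] at hI
    exact ha (Ideal.span_singleton_eq_bot.mp hI)
  have hIc : ClassGroup.mk0 ⟨I, mem_nonZeroDivisors_of_ne_zero hI0⟩ = (ClassGroup.mk0 J)⁻¹ := by
    have h1 := (ClassGroup.mk0_eq_one_iff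
      (⟨I, mem_nonZeroDivisors_of_ne_zero hI0⟩ * J : (Ideal (𝓞 K))⁰).2).mpr
      ⟨a, by simpa [mul_comm] using hI.symm⟩
    rw [eq_inv_iff_mul_eq_one, ← map_mul]
    exact h1
  have h1 : Ideal.span {γ ⟨_, hIc⟩} = Ideal.span {a} := by rw [hγ, hI, mul_comm]
  obtain ⟨u, hu⟩ := Ideal.span_singleton_eq_span_singleton.mp h1
  exact ⟨⟨_, hIc⟩, u, by rw [unit_smul_generator, ← hu, mul_comm]⟩

theorem norm_smul_generator (hγ : ∀ I, Ideal.span {γ I} = (I.1.1 : Ideal (𝓞 K)) * J) (I)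
    {τ : ℝ} (hτ : 0 < τ) : mixedEmbedding.norm (τ • mixedEmbedding K (γ I : K)) =
      τ ^ finrank ℚ K * ((Ideal.absNorm I.1.1 : ℝ) * (Ideal.absNorm J.1 : ℝ)) := by
  rw [mixedEmbedding.norm_smul, abs_of_pos hτ, norm_mixedEmbedding_eq_absNorm_span, hγ,
    map_mul Ideal.absNorm, Nat.cast_mul]

end UnitOrbits

/-- Sums of `normBump g` over the nonzero elements of an integral ideal `J` are sums of `g` over
the norms of the ideals in the class of `J⁻¹`. -/
theorem tsum_idealLattice_normBump {g : ℝ → ℝ} (hs : HasCompactSupport g)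
    (h0 : tsupport g ⊆ Set.Ioi 0) (J : (Ideal (𝓞 K))⁰) {τ : ℝ} (hτ : 0 < τ) :
    ∑' x : Submodule.span ℤ (Set.range (fractionalIdealLatticeBasis K (FractionalIdeal.mk0 K J))),
        normBump g (τ • (x : mixedSpace K)) =
      torsionOrder K * ∑' I : {I : (Ideal (𝓞 K))⁰ // ClassGroup.mk0 I = (ClassGroup.mk0 J)⁻¹},
        g (τ ^ finrank ℚ K * ((Ideal.absNorm I.1.1 : ℝ) * (Ideal.absNorm J.1 : ℝ))) := by
  have hg0 : g 0 = 0 := image_eq_zero_of_notMem_tsupport fun h ↦ lt_irrefl (0 : ℝ) (h0 h)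
  have hsum := hasFiniteSupport_span_basis (fractionalIdealLatticeBasis K (FractionalIdeal.mk0 K J))
    (hasCompactSupport_normBump (K := K) hs h0) hτ
  have hΛ := mem_span_idealLatticeBasis_mk0 J
  set Λ := Submodule.span ℤ
    (Set.range (fractionalIdealLatticeBasis K (FractionalIdeal.mk0 K J)))
  choose γ hγ using fun I : {I : (Ideal (𝓞 K))⁰ // ClassGroup.mk0 I = (ClassGroup.mk0 J)⁻¹} ↦
    exists_span_singleton_eq_mul I.2
  have hinj := injective_unit_smul_generator hγ
  -- Extended by zero, the sum can be reindexed by pairs (ideal, unit). The origin, which lies in no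
  -- orbit, contributes nothing because `g 0 = 0`.
  let Φ : mixedSpace K → ℝ := (Λ : Set (mixedSpace K)).indicator fun x ↦ normBump g (τ • x)
  replace hsum : Summable Φ := summable_subtype_iff_indicator.mp hsum
  have hrange : Function.support Φ ⊆
      Set.range fun p : _ × (𝓞 K)ˣ ↦ p.2 • mixedEmbedding K (γ p.1 : K) := by
    intro x hx
    obtain ⟨hxΛ, hx0⟩ := Set.indicator_apply_ne_zero.mp hx
    obtain ⟨a, haJ, rfl⟩ := (hΛ x).mp hxΛ
    have ha : a ≠ 0 := by
      rintro rfl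
      simp [normBump, hg0] at hx0
    obtain ⟨I, u, h⟩ := exists_unit_smul_generator_eq hγ haJ ha
    exact ⟨(I, u), h⟩
  have hmem : ∀ I, ∀ u : (𝓞 K)ˣ, u • mixedEmbedding K (γ I : K) ∈ Λ := by
    intro I u
    exact (hΛ _).mpr ⟨u * γ I, J.1.mul_mem_left _ (generator_mem hγ I),
      (unit_smul_generator I u).symm⟩
  have hfib : ∀ I, ∑' u : (𝓞 K)ˣ, Φ (u • mixedEmbedding K (γ I : K)) = torsionOrder K *
      g (τ ^ finrank ℚ K * ((Ideal.absNorm I.1.1 : ℝ) * (Ideal.absNorm J.1 : ℝ))) := by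
    intro I
    have hne : mixedEmbedding.norm (τ • mixedEmbedding K (γ I : K)) ≠ 0 := by
      rw [norm_smul_generator hγ I hτ]
      have h1 := Ideal.absNorm_ne_zero_of_nonZeroDivisors I.1
      have h2 := Ideal.absNorm_ne_zero_of_nonZeroDivisors J
      positivity
    rw [← norm_smul_generator hγ I hτ, ← (hasSum_normBump_unit_smul g hne).tsum_eq]
    refine tsum_congr fun u ↦ ?_
    refine (Set.indicator_of_mem (hmem I u) _).trans ?_
    rw [unitSMul_smul, unitSMul_smul, mul_smul_comm]
  calc ∑' x : Λ, normBump g (τ • (x : mixedSpace K)) = ∑' x, Φ x :=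
        tsum_subtype (Λ : Set (mixedSpace K)) fun x ↦ normBump g (τ • x)
    _ = ∑' p : _ × (𝓞 K)ˣ, Φ (p.2 • mixedEmbedding K (γ p.1 : K)) := (hinj.tsum_eq hrange).symm
    _ = ∑' I, ∑' u : (𝓞 K)ˣ, Φ (u • mixedEmbedding K (γ I : K)) :=
        (hsum.comp_injective hinj).tsum_prod
    _ = _ := by rw [tsum_congr hfib, tsum_mul_left]

/-- Smooth sums over the norms of the ideals of a fixed class. -/
theorem exists_abs_tsum_class_sub_le {g : ℝ → ℝ} (hg : ContDiff ℝ (⊤ : ℕ∞) g)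
    (hs : HasCompactSupport g) (h0 : tsupport g ⊆ Set.Ioi 0) (c : ClassGroup (𝓞 K)) :
    ∃ C D, ∀ t : ℝ, 0 < t → t ≤ 1 →
      |∑' I : {I : (Ideal (𝓞 K))⁰ // ClassGroup.mk0 I = c},
        g (t * (Ideal.absNorm (I : Ideal (𝓞 K)) : ℝ)) - C / t| ≤ D := by
  obtain ⟨J, hJ⟩ := ClassGroup.mk0_surjective c⁻¹
  obtain rfl : c = (ClassGroup.mk0 J)⁻¹ := by rw [hJ, inv_inv]
  set b := fractionalIdealLatticeBasis K (FractionalIdeal.mk0 K J)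
  have hcard : Fintype.card (Free.ChooseBasisIndex ℤ (FractionalIdeal.mk0 K J)) = finrank ℚ K := by
    rw [← finrank_eq_card_chooseBasisIndex, fractionalIdeal_rank, RingOfIntegers.rank]
  have hn : finrank ℚ K ≠ 0 := finrank_pos.ne'
  have : Nonempty (Free.ChooseBasisIndex ℤ (FractionalIdeal.mk0 K J)) := by
    rw [← Fintype.card_pos_iff, hcard]; exact finrank_pos
  obtain ⟨C, D, h⟩ := exists_abs_tsum_span_basis_sub_le b (contDiff_normBump (K := K) hg h0)
    (hasCompactSupport_normBump (K := K) hs h0)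
  have hw : (0 : ℝ) < torsionOrder K := Nat.cast_pos.mpr (torsionOrder_pos K)
  have hN : (1 : ℝ) ≤ Ideal.absNorm (J : Ideal (𝓞 K)) :=
    Nat.one_le_cast.mpr (Nat.pos_of_ne_zero (Ideal.absNorm_ne_zero_of_nonZeroDivisors J))
  set N : ℝ := (Ideal.absNorm (J : Ideal (𝓞 K)) : ℝ)
  refine ⟨C * N / torsionOrder K, D / torsionOrder K, fun t ht h1 ↦ ?_⟩
  -- Chosen so that `τ ^ n * N = t`: the scaled norm of a generator of `I * J` is then `t` times the
  -- norm of `I`, and the lattice main term is a multiple of `1 / t`.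
  set τ : ℝ := (t / N) ^ ((finrank ℚ K : ℝ)⁻¹)
  have hτ : 0 < τ := by positivity
  have hτ1 : τ ≤ 1 := by
    refine Real.rpow_le_one (by positivity) ?_ (by positivity)
    rw [div_le_one (by positivity)]
    linarith
  have hτn : τ ^ finrank ℚ K = t / N := Real.rpow_inv_natCast_pow (by positivity) hn
  have h2 := h τ hτ hτ1
  rw [tsum_idealLattice_normBump hs h0 J hτ, hcard, hτn] at h2
  rw [le_div_iff₀ hw, ← abs_of_pos hw, ← abs_mul, abs_of_pos hw]
  refine le_of_eq_of_le ?_ h2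
  congr 1
  rw [sub_mul, mul_comm]
  congr 1
  · congr 1
    refine tsum_congr fun I ↦ ?_
    congr 1
    change _ = t / N * (_ * N)
    field_simp
  · field_simp

end NumberField.mixedEmbedding

theorem tsum_eq_tsum_fiber {α β : Type*} (φ : α → β) {f : α → ℝ} (hf : Summable f) :
    ∑' a, f a = ∑' b, ∑' p : {a // φ a = b}, f p := by
  rw [← (Equiv.sigmaFiberEquiv φ).tsum_eq]
  exact ((Equiv.sigmaFiberEquiv φ).summable_iff.mpr hf).tsum_sigma

/-! ### Smooth sums over all nonzero ideals -/

section IdealSums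

variable (K : Type*) [Field K] [NumberField K]

/-- The number of ideals of norm `n`. -/
noncomputable def idealNormCount (n : ℕ) : ℕ := Nat.card {I : Ideal (𝓞 K) // Ideal.absNorm I = n}

/-- The sum of `g (t * N I)` over the nonzero ideals `I`, provided that `g 0 = 0`. -/
noncomputable def idealSum (g : ℝ → ℝ) (t : ℝ) : ℝ := ∑' n : ℕ, idealNormCount K n * g (t * n)

variable {K}

theorem exists_forall_lt_eq_zero {g : ℝ → ℝ} (hs : HasCompactSupport g) :
    ∃ b, 1 ≤ b ∧ ∀ x, b < x → g x = 0 := by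
  obtain ⟨R, hR⟩ := hs.isCompact.isBounded.exists_norm_le
  refine ⟨max R 1, le_max_right _ _, fun x hx ↦ ?_⟩
  by_contra hc
  have := hR x (subset_tsupport _ hc)
  exact absurd ((le_abs_self x).trans this) (not_le.mpr ((le_max_left _ _).trans_lt hx))

theorem apply_zero_of_tsupport_subset {g : ℝ → ℝ} (h0 : tsupport g ⊆ Set.Ioi 0) : g 0 = 0 :=
  image_eq_zero_of_notMem_tsupport fun h ↦ lt_irrefl (0 : ℝ) (h0 h)

theorem finite_support_comp_absNorm {g : ℝ → ℝ} (hs : HasCompactSupport g) {t : ℝ} (ht : 0 < t) :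
    (Function.support fun I : (Ideal (𝓞 K))⁰ ↦ g (t * (Ideal.absNorm I.1 : ℝ))).Finite := by
  obtain ⟨b, hb1, hb⟩ := exists_forall_lt_eq_zero hs
  refine (Ideal.finite_setOfPred_absNorm_le₀ ⌊b / t⌋₊).subset fun I hI ↦ ?_
  by_contra hc
  refine hI (hb _ ?_)
  have h1 := (Nat.floor_lt (by positivity : 0 ≤ b / t)).mp (not_le.mp hc)
  rwa [div_lt_iff₀ ht, mul_comm] at h1

theorem idealSum_eq_tsum {g : ℝ → ℝ} (hs : HasCompactSupport g) (h0 : g 0 = 0) {t : ℝ}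
    (ht : 0 < t) : idealSum K g t = ∑' I : (Ideal (𝓞 K))⁰, g (t * (Ideal.absNorm I.1 : ℝ)) := by
  have hsum : Summable fun I : (Ideal (𝓞 K))⁰ ↦ g (t * (Ideal.absNorm I.1 : ℝ)) :=
    summable_of_hasFiniteSupport (finite_support_comp_absNorm hs ht)
  rw [tsum_eq_tsum_fiber (fun I : (Ideal (𝓞 K))⁰ ↦ Ideal.absNorm I.1) hsum, idealSum]
  refine tsum_congr fun n ↦ ?_
  have h1 : ∀ p : {I : (Ideal (𝓞 K))⁰ // Ideal.absNorm I.1 = n},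
      g (t * (Ideal.absNorm p.1.1 : ℝ)) = g (t * n) := fun p ↦ by rw [p.2]
  rw [tsum_congr h1, tsum_const, nsmul_eq_mul]
  -- `idealNormCount K 0` counts the zero ideal, while no nonzero ideal has norm `0`; the mismatch
  -- is cancelled by `g 0 = 0`.
  rcases Nat.eq_zero_or_pos n with rfl | hn
  · simp [h0]
  · congr 2
    exact Nat.card_congr
      ⟨fun I ↦ ⟨⟨I.1, mem_nonZeroDivisors_of_ne_zero fun h ↦ by
          have h2 := I.2
          rw [h, Ideal.zero_eq_bot, Ideal.absNorm_bot] at h2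
          omega⟩, I.2⟩, fun I ↦ ⟨I.1.1, I.2⟩, fun _ ↦ rfl, fun _ ↦ rfl⟩

/-- Smooth sums over ideals have a single main term up to a bounded error. -/
theorem exists_abs_idealSum_sub_le {g : ℝ → ℝ} (hg : ContDiff ℝ (⊤ : ℕ∞) g)
    (hs : HasCompactSupport g) (h0 : tsupport g ⊆ Set.Ioi 0) :
    ∃ C D, ∀ t : ℝ, 0 < t → t ≤ 1 → |idealSum K g t - C / t| ≤ D := by
  choose C D h using mixedEmbedding.exists_abs_tsum_class_sub_le (K := K) hg hs h0
  refine ⟨∑ c, C c, ∑ c, D c, fun t ht h1 ↦ ?_⟩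
  have hsum : Summable fun I : (Ideal (𝓞 K))⁰ ↦ g (t * (Ideal.absNorm I.1 : ℝ)) :=
    summable_of_hasFiniteSupport (finite_support_comp_absNorm hs ht)
  rw [idealSum_eq_tsum hs (apply_zero_of_tsupport_subset h0) ht,
    tsum_eq_tsum_fiber ClassGroup.mk0 hsum, tsum_fintype, Finset.sum_div, ← Finset.sum_sub_distrib]
  exact (Finset.abs_sum_le_sum_abs _ _).trans (Finset.sum_le_sum fun c _ ↦ h c t ht h1)

theorem hasFiniteSupport_idealSum {g : ℝ → ℝ} {b : ℝ} (hb : ∀ x, b < x → g x = 0) {t₀ : ℝ}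
    (ht₀ : 0 < t₀) {t : ℝ} (ht : t₀ ≤ t) {n : ℕ} (hn : n ∉ Finset.range (⌊b / t₀⌋₊ + 1)) :
    idealNormCount K n * g (t * n) = 0 := by
  have h1 : ⌊b / t₀⌋₊ < n := by simpa [Nat.lt_succ_iff] using hn
  rw [hb, mul_zero]
  have h2 : b / t₀ < n := Nat.lt_of_floor_lt h1
  rw [div_lt_iff₀ ht₀, mul_comm] at h2
  exact h2.trans_le (mul_le_mul_of_nonneg_right ht (Nat.cast_nonneg n))

theorem idealSum_eq_sum {g : ℝ → ℝ} {b : ℝ} (hb : ∀ x, b < x → g x = 0) {t₀ : ℝ}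
    (ht₀ : 0 < t₀) {t : ℝ} (ht : t₀ ≤ t) :
    idealSum K g t = ∑ n ∈ Finset.range (⌊b / t₀⌋₊ + 1), idealNormCount K n * g (t * n) :=
  tsum_eq_sum fun _ hn ↦ hasFiniteSupport_idealSum hb ht₀ ht hn

theorem continuousOn_idealSum {g : ℝ → ℝ} (hg : Continuous g) (hs : HasCompactSupport g) :
    ContinuousOn (idealSum K g) (Set.Ioi 0) := by
  obtain ⟨b, -, hb⟩ := exists_forall_lt_eq_zero hs
  intro t ht
  have ht2 : 0 < t / 2 := half_pos ht
  refine ContinuousAt.continuousWithinAt ?_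
  have hev : idealSum K g =ᶠ[nhds t] fun t' ↦ ∑ n ∈ Finset.range (⌊b / (t / 2)⌋₊ + 1),
      (idealNormCount K n : ℝ) * g (t' * n) := by
    filter_upwards [lt_mem_nhds (half_lt_self ht)] with t' ht'
    exact idealSum_eq_sum hb ht2 ht'.le
  refine ContinuousAt.congr ?_ hev.symm
  fun_prop

theorem idealSum_eq_zero {g : ℝ → ℝ} {b : ℝ} (hb : ∀ x, b < x → g x = 0) (h0 : g 0 = 0) {t : ℝ}
    (hb0 : 0 ≤ b) (ht : b < t) : idealSum K g t = 0 := by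
  refine (tsum_congr fun n ↦ ?_).trans tsum_zero
  rcases Nat.eq_zero_or_pos n with rfl | hn
  · simp [h0]
  · rw [hb _ (ht.trans_le (le_mul_of_one_le_right (hb0.trans ht.le) (Nat.one_le_cast.mpr hn))),
      mul_zero]

end IdealSums

/-! ### Test functions and Mellin transforms -/

/-- Smooth functions with compact support in `(0, ∞)`. -/
structure IsTestFunction (g : ℝ → ℝ) : Prop where
  contDiff : ContDiff ℝ (⊤ : ℕ∞) g
  hasCompactSupport : HasCompactSupport g
  tsupport_subset : tsupport g ⊆ Set.Ioi 0

section Mellin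

/-- Source of the reflection symmetry that carries bounds from the upper half of the critical line
to the lower half. -/
theorem mellin_ofReal_conj (f : ℝ → ℝ) (s : ℂ) :
    mellin (fun t ↦ (f t : ℂ)) ((starRingEnd ℂ) s) =
      (starRingEnd ℂ) (mellin (fun t ↦ (f t : ℂ)) s) := by
  rw [mellin, mellin, ← integral_conj]
  refine MeasureTheory.setIntegral_congr_fun measurableSet_Ioi fun t ht ↦ ?_
  have h1 : (t : ℂ).arg ≠ π := by
    rw [Complex.arg_ofReal_of_nonneg (le_of_lt ht)]; exact Real.pi_pos.ne
  have h2 := Complex.cpow_conj (t : ℂ) (s - 1) h1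
  simp only [map_sub, map_one, Complex.conj_ofReal] at h2
  simp only [smul_eq_mul, map_mul, Complex.conj_ofReal, h2]

variable {F : ℝ → ℂ} {b D : ℝ}

theorem isBigO_atTop_of_forall_lt_eq_zero (hb : ∀ t, b < t → F t = 0) (a : ℝ) :
    F =O[atTop] (fun t : ℝ ↦ t ^ (-a)) := by
  refine EventuallyEq.trans_isBigO ?_ (isBigO_zero _ _)
  filter_upwards [eventually_gt_atTop b] with t ht using hb t ht

theorem isBigO_nhdsGT_zero_of_bound (hD : ∀ t, 0 < t → t ≤ 1 → ‖F t‖ ≤ D) :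
    F =O[nhdsWithin 0 (Set.Ioi 0)] (fun t : ℝ ↦ t ^ (-(0 : ℝ))) := by
  refine IsBigO.of_bound D ?_
  filter_upwards [Ioc_mem_nhdsGT (zero_lt_one (α := ℝ))] with t ht
  simpa using hD t ht.1 ht.2

theorem mellinConvergent_of_bounded (hc : ContinuousOn F (Set.Ioi 0)) (hb : ∀ t, b < t → F t = 0)
    (hD : ∀ t, 0 < t → t ≤ 1 → ‖F t‖ ≤ D) {s : ℂ} (hs : 0 < s.re) : MellinConvergent F s :=
  mellinConvergent_of_isBigO_rpow (hc.locallyIntegrableOn measurableSet_Ioi)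
    (isBigO_atTop_of_forall_lt_eq_zero hb _) (lt_add_one _) (isBigO_nhdsGT_zero_of_bound hD) hs

theorem differentiableAt_mellin_of_bounded (hc : ContinuousOn F (Set.Ioi 0))
    (hb : ∀ t, b < t → F t = 0) (hD : ∀ t, 0 < t → t ≤ 1 → ‖F t‖ ≤ D) {s : ℂ} (hs : 0 < s.re) :
    DifferentiableAt ℂ (mellin F) s :=
  mellin_differentiableAt_of_isBigO_rpow (hc.locallyIntegrableOn measurableSet_Ioi)
    (isBigO_atTop_of_forall_lt_eq_zero hb _) (lt_add_one _) (isBigO_nhdsGT_zero_of_bound hD) hs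

/-- The function `max (1 / t - 1) 0`, whose Mellin transform has a pole at `s = 1`. -/
noncomputable def poleKernel (t : ℝ) : ℝ := max (1 / t - 1) 0

theorem poleKernel_of_one_le {t : ℝ} (ht : 1 ≤ t) : poleKernel t = 0 :=
  max_eq_right (by rw [sub_nonpos, div_le_one (by linarith)]; exact ht)

theorem poleKernel_of_le_one {t : ℝ} (h0 : 0 < t) (ht : t ≤ 1) : poleKernel t = 1 / t - 1 :=
  max_eq_left (by rw [sub_nonneg, le_div_iff₀ h0]; linarith)

theorem continuousOn_poleKernel : ContinuousOn poleKernel (Set.Ioi 0) :=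
  ((continuousOn_const.div continuousOn_id fun _ h ↦ (ne_of_gt h)).sub continuousOn_const).sup
    continuousOn_const

/-- On `(0, 1]` the kernel is `t⁻¹ - 1`, with transform `1 / (s - 1) - 1 / s`. The `-1` makes the
kernel continuous at `1`, as pointwise inversion requires, and gives the transform quadratic decay.
-/
theorem hasMellin_poleKernel {s : ℂ} (hs : 1 < s.re) :
    HasMellin (fun t ↦ (poleKernel t : ℂ)) s (1 / (s * (s - 1))) := by
  have h1 := hasMellin_cpow_Ioc (-1) (s := s) (by simpa using hs)
  have h2 := hasMellin_one_Ioc (s := s) (by linarith)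
  have h3 := hasMellin_sub h1.1 h2.1
  rw [h1.2, h2.2] at h3
  have hs0 : s ≠ 0 := by rintro rfl; simp at hs; linarith
  have hs1 : s - 1 ≠ 0 := by
    intro h; rw [sub_eq_zero] at h; rw [h] at hs; simp at hs
  have h4 : 1 / (s + -1) - 1 / s = 1 / (s * (s - 1)) := by
    rw [← sub_eq_add_neg]; field_simp; ring
  rw [h4] at h3
  have heq : Set.EqOn (fun t : ℝ ↦ (t : ℂ) ^ (s - 1) •
      (Set.indicator (Set.Ioc 0 1) (fun t : ℝ ↦ (t : ℂ) ^ (-1 : ℂ)) t -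
        Set.indicator (Set.Ioc 0 1) (fun _ ↦ (1 : ℂ)) t))
      (fun t : ℝ ↦ (t : ℂ) ^ (s - 1) • (poleKernel t : ℂ)) (Set.Ioi 0) := by
    intro t ht
    simp only
    congr 1
    by_cases h : t ≤ 1
    · have hmem : t ∈ Set.Ioc (0 : ℝ) 1 := ⟨ht, h⟩
      rw [Set.indicator_of_mem hmem, Set.indicator_of_mem hmem,
        poleKernel_of_le_one ht h, Complex.cpow_neg_one]
      push_cast
      rw [one_div]
    · have hmem : t ∉ Set.Ioc (0 : ℝ) 1 := fun h' ↦ h h'.2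
      rw [Set.indicator_of_notMem hmem, Set.indicator_of_notMem hmem,
        poleKernel_of_one_le (not_le.mp h).le]
      simp
  refine ⟨(MeasureTheory.integrableOn_congr_fun heq measurableSet_Ioi).mp h3.1, ?_⟩
  rw [← h3.2]
  exact (MeasureTheory.setIntegral_congr_fun measurableSet_Ioi heq).symm

end Mellin

namespace IsTestFunction

variable {g : ℝ → ℝ}

theorem exists_bound (hg : IsTestFunction g) : ∃ D, ∀ t, ‖(g t : ℂ)‖ ≤ D := by
  obtain ⟨D, hD⟩ := hg.hasCompactSupport.exists_bound_of_continuous hg.contDiff.continuous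
  exact ⟨D, fun t ↦ by simpa using hD t⟩

theorem mellinConvergent (hg : IsTestFunction g) {s : ℂ} (hs : 0 < s.re) :
    MellinConvergent (fun t ↦ (g t : ℂ)) s := by
  obtain ⟨D, hD⟩ := hg.exists_bound
  obtain ⟨b, -, hb⟩ := exists_forall_lt_eq_zero hg.hasCompactSupport
  exact mellinConvergent_of_bounded
    (Complex.continuous_ofReal.comp hg.contDiff.continuous).continuousOn
    (b := b) (fun t ht ↦ by simp [hb t ht]) (fun t _ _ ↦ hD t) hs

theorem differentiableAt_mellin (hg : IsTestFunction g) {s : ℂ} (hs : 0 < s.re) :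
    DifferentiableAt ℂ (mellin fun t ↦ (g t : ℂ)) s := by
  obtain ⟨D, hD⟩ := hg.exists_bound
  obtain ⟨b, -, hb⟩ := exists_forall_lt_eq_zero hg.hasCompactSupport
  exact differentiableAt_mellin_of_bounded
    (Complex.continuous_ofReal.comp hg.contDiff.continuous).continuousOn
    (b := b) (fun t ht ↦ by simp [hb t ht]) (fun t _ _ ↦ hD t) hs

theorem mellin_one : mellin (fun t ↦ (g t : ℂ)) 1 = ((∫ t in Set.Ioi 0, g t : ℝ) : ℂ) := by
  rw [mellin, ← integral_complex_ofReal]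
  simp

end IsTestFunction

/-- At each point, some test function has a nonvanishing Mellin transform. -/
theorem exists_isTestFunction_mellin_ne_zero (s : ℂ) :
    ∃ g, IsTestFunction g ∧ mellin (fun t ↦ (g t : ℂ)) s ≠ 0 := by
  by_contra! hcon
  have hc : ContinuousOn (fun t : ℝ ↦ (t : ℂ) ^ (s - 1)) (Set.Ioi 0) := fun t ht ↦
    (Complex.continuousAt_ofReal_cpow_const t _ (Or.inr (ne_of_gt ht))).continuousWithinAt
  -- If every transform vanished at `s`, the fundamental lemma of the calculus of variations would
  -- force `t ^ (s - 1) = 0` almost everywhere on `(0, ∞)`.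
  have h := isOpen_Ioi.ae_eq_zero_of_integral_contDiff_smul_eq_zero (μ := MeasureTheory.volume)
    (hc.locallyIntegrableOn measurableSet_Ioi) fun g hg hs h0 ↦ ?_
  · have h1 : ∀ᵐ t : ℝ, t ∉ Set.Ioi (0 : ℝ) := by
      filter_upwards [h] with t ht hmem
      have := ht hmem
      rw [Complex.cpow_eq_zero_iff] at this
      exact (ne_of_gt hmem) (by exact_mod_cast this.1)
    have h2 : MeasureTheory.volume (Set.Ioi (0 : ℝ)) = 0 := by
      rw [MeasureTheory.ae_iff] at h1
      simp only [not_not] at h1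
      exact h1
    rw [Real.volume_Ioi] at h2
    exact ENNReal.top_ne_zero h2
  · rw [← hcon g ⟨hg, hs, h0⟩, mellin, MeasureTheory.setIntegral_eq_integral_of_forall_compl_eq_zero]
    · refine MeasureTheory.integral_congr_ae (Eventually.of_forall fun t ↦ ?_)
      simp [mul_comm]
    · intro t ht
      rw [image_eq_zero_of_notMem_tsupport fun h ↦ ht (h0 h), Complex.ofReal_zero, smul_zero]

/-! ### The Dirichlet series and Mellin transforms of ideal sums -/

section Zeta

variable (K : Type*) [Field K] [NumberField K]

theorem dedekindZeta_eq_LSeries :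
    dedekindZeta K = LSeries fun n ↦ ((idealNormCount K n : ℝ) : ℂ) := by
  ext s
  simp [dedekindZeta, idealNormCount]

theorem tendsto_sum_idealNormCount_div :
    Tendsto (fun n : ℕ ↦ (∑ k ∈ Finset.Icc 1 n, (idealNormCount K k : ℝ)) / n) atTop
      (nhds (dedekindZeta_residue K)) := by
  refine ((Ideal.tendsto_norm_le_div_atTop₀ K).comp tendsto_natCast_atTop_atTop).congr fun n ↦ ?_
  simp only [Function.comp_apply, Nat.cast_le, ← Nat.cast_sum, idealNormCount]
  congr
  rw [← add_left_inj 1, ← Ideal.card_norm_le_eq_card_norm_le_add_one,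
    show Finset.Icc 1 n = Finset.Ioc 0 n from Finset.Icc_succ_left_eq_Ioc _ _,
    show 1 = Nat.card {I : Ideal (𝓞 K) // Ideal.absNorm I = 0} by simp [Ideal.absNorm_eq_zero_iff],
    Finset.sum_Ioc_add_eq_sum_Icc (n.zero_le),
    ← Finset.card_preimage_eq_sum_card_image_eq (fun k _ ↦ Ideal.finite_setOfPred_absNorm_eq k)]
  simp [Set.coe_eq_subtype]

theorem summable_idealNormCount {s : ℂ} (hs : 1 < s.re) :
    LSeriesSummable (fun n ↦ ((idealNormCount K n : ℝ) : ℂ)) s := by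
  refine LSeriesSummable_of_sum_norm_bigO_and_nonneg (r := 1) ?_ (fun _ ↦ Nat.cast_nonneg _)
    zero_le_one hs
  have h1 := (tendsto_sum_idealNormCount_div K).isBigO_one ℝ
  have h2 := h1.mul (isBigO_refl (fun n : ℕ ↦ (n : ℝ)) atTop)
  refine (h2.congr' ?_ ?_)
  · filter_upwards [eventually_ne_atTop 0] with n hn
    rw [div_mul_cancel₀ _ (Nat.cast_ne_zero.mpr hn)]
  · filter_upwards with n
    simp

variable {K} {g : ℝ → ℝ}

/-- The Mellin transform of a smooth sum over ideals. -/
theorem mellin_idealSum (hg : IsTestFunction g) {s : ℂ} (hs : 1 < s.re) :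
    mellin (fun t ↦ (idealSum K g t : ℂ)) s = mellin (fun t ↦ (g t : ℂ)) s * dedekindZeta K s := by
  have hg0 := apply_zero_of_tsupport_subset hg.tsupport_subset
  have hs0 : 0 < s.re := by linarith
  obtain ⟨b, -, hb⟩ := exists_forall_lt_eq_zero hg.hasCompactSupport
  set G : ℝ → ℂ := fun t ↦ (g t : ℂ)
  let f : ℕ → ℝ → ℂ := fun n t ↦ (t : ℂ) ^ (s - 1) * ((idealNormCount K n : ℂ) * G (t * n))
  have hterm : ∀ n, ∫ t in Set.Ioi (0 : ℝ), f n t =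
      LSeries.term (fun n ↦ ((idealNormCount K n : ℝ) : ℂ)) s n * mellin G s := by
    intro n
    rcases Nat.eq_zero_or_pos n with rfl | hn
    · simp [f, G, hg0]
    · rw [LSeries.term_of_ne_zero hn.ne']
      have h1 := mellin_comp_mul_right G s (a := n) (by exact_mod_cast hn)
      have h2 := mellin_const_smul (fun t : ℝ ↦ G (t * n)) s (idealNormCount K n : ℂ)
      rw [h1] at h2
      simp only [mellin, smul_eq_mul] at h2
      simp only [f]
      rw [h2, Complex.cpow_neg, mellin]
      simp only [smul_eq_mul]
      push_cast
      ring
  have hint : ∀ n, MeasureTheory.IntegrableOn (f n) (Set.Ioi 0) := by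
    intro n
    rcases Nat.eq_zero_or_pos n with rfl | hn
    · simp [f, G, hg0]
    · have h2 := (hg.mellinConvergent hs0)
      rw [← MellinConvergent.comp_mul_left (a := n) (by exact_mod_cast hn)] at h2
      have h3 := h2.const_smul (idealNormCount K n : ℂ)
      refine h3.congr_fun (fun t _ ↦ ?_) measurableSet_Ioi
      simp [f, G, mul_comm (n : ℝ)]
  -- Rescaling `t` factors the `L¹` norm into the absolute value of the Dirichlet series term and a
  -- fixed integral, so absolute convergence of the series justifies exchanging sum and integral.
  have hnorm : ∀ n, ∫ t in Set.Ioi (0 : ℝ), ‖f n t‖ =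
      ‖LSeries.term (fun n ↦ ((idealNormCount K n : ℝ) : ℂ)) s n‖ *
        ∫ t in Set.Ioi (0 : ℝ), ‖(t : ℂ) ^ (s - 1) * G t‖ := by
    intro n
    rcases Nat.eq_zero_or_pos n with rfl | hn
    · simp [f, G, hg0]
    · have hn' : (0 : ℝ) < n := by exact_mod_cast hn
      rw [LSeries.norm_term_eq, if_neg hn.ne']
      have h1 := MeasureTheory.integral_comp_mul_right_Ioi
        (fun t : ℝ ↦ ‖(t : ℂ) ^ (s - 1) * G t‖) 0 hn'
      rw [zero_mul] at h1
      have h2 : ∀ t ∈ Set.Ioi (0 : ℝ), ‖f n t‖ = ((idealNormCount K n : ℝ) * (n : ℝ) ^ (1 - s.re)) *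
          ‖((t * n : ℝ) : ℂ) ^ (s - 1) * G (t * n)‖ := by
        intro t ht
        have ht' : (0 : ℝ) < t := ht
        simp only [f, norm_mul]
        rw [Complex.norm_cpow_eq_rpow_re_of_pos ht', Complex.norm_cpow_eq_rpow_re_of_pos
          (mul_pos ht' hn'), Real.mul_rpow ht'.le hn'.le, show 1 - s.re = -(s - 1).re by simp,
          Real.rpow_neg hn'.le]
        have : (n : ℝ) ^ (s - 1).re ≠ 0 := (Real.rpow_pos_of_pos hn' _).ne'
        simp only [Complex.norm_natCast]
        field_simp
      rw [MeasureTheory.setIntegral_congr_fun measurableSet_Ioi h2,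
        MeasureTheory.integral_const_mul, h1, Real.rpow_sub hn', Real.rpow_one, smul_eq_mul]
      simp only [Complex.norm_real, Real.norm_natCast]
      field_simp
  have hsum := summable_idealNormCount K hs
  have hkey := MeasureTheory.hasSum_integral_of_summable_integral_norm hint
    (by simp_rw [hnorm]; exact hsum.norm.mul_right _)
  simp_rw [hterm] at hkey
  have h3 : HasSum (fun n ↦ LSeries.term (fun n ↦ ((idealNormCount K n : ℝ) : ℂ)) s n * mellin G s)
      (dedekindZeta K s * mellin G s) := by
    rw [dedekindZeta_eq_LSeries]
    exact hsum.hasSum.mul_right _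
  rw [mul_comm, h3.unique hkey, mellin]
  refine MeasureTheory.setIntegral_congr_fun measurableSet_Ioi fun t ht ↦ ?_
  simp only [f, smul_eq_mul, tsum_mul_left, idealSum, Complex.ofReal_tsum]
  simp [G]

end Zeta

/-! ### Analytic continuation of the zeta function and its size on the critical line -/

section Continuation

variable {K : Type*} [Field K] [NumberField K] {g : ℝ → ℝ}

theorem remainder_eq_zero (hg : IsTestFunction g) (C : ℝ) : ∃ b, ∀ t, b < t →
    ((idealSum K g t - C * poleKernel t : ℝ) : ℂ) = 0 := by
  obtain ⟨b, hb1, hb⟩ := exists_forall_lt_eq_zero hg.hasCompactSupport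
  refine ⟨b, fun t ht ↦ ?_⟩
  rw [idealSum_eq_zero hb (apply_zero_of_tsupport_subset hg.tsupport_subset) (by linarith) ht,
    poleKernel_of_one_le (by linarith)]
  simp

theorem continuousOn_remainder (hg : IsTestFunction g) (C : ℝ) :
    ContinuousOn (fun t ↦ ((idealSum K g t - C * poleKernel t : ℝ) : ℂ)) (Set.Ioi 0) :=
  Complex.continuous_ofReal.comp_continuousOn
    ((continuousOn_idealSum hg.contDiff.continuous hg.hasCompactSupport).sub
      (continuousOn_const.mul continuousOn_poleKernel))

theorem norm_remainder_le {C D : ℝ}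
    (h : ∀ t : ℝ, 0 < t → t ≤ 1 → |idealSum K g t - C / t| ≤ D) (t : ℝ) (h0 : 0 < t) (h1 : t ≤ 1) :
    ‖((idealSum K g t - C * poleKernel t : ℝ) : ℂ)‖ ≤ D + |C| := by
  rw [Complex.norm_real, Real.norm_eq_abs, poleKernel_of_le_one h0 h1]
  calc |idealSum K g t - C * (1 / t - 1)| = |(idealSum K g t - C / t) + C| := by
        congr 1; ring
    _ ≤ _ := (abs_add_le _ _).trans (by gcongr; exact h t h0 h1)

/-- The left side is holomorphic for `0 < Re s`, because the remainder is bounded near `0` and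
vanishes for large `t`; this identity is therefore what continues the right side. -/
theorem mellin_remainder (hg : IsTestFunction g) {C D : ℝ}
    (h : ∀ t : ℝ, 0 < t → t ≤ 1 → |idealSum K g t - C / t| ≤ D) {s : ℂ} (hs : 1 < s.re) :
    mellin (fun t ↦ ((idealSum K g t - C * poleKernel t : ℝ) : ℂ)) s =
      mellin (fun t ↦ (g t : ℂ)) s * dedekindZeta K s - C / (s * (s - 1)) := by
  obtain ⟨b, hb⟩ := remainder_eq_zero (K := K) hg C
  have h1 := mellinConvergent_of_bounded (continuousOn_remainder hg C) hb (norm_remainder_le h)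
    (s := s) (by linarith)
  have h2 := hasMellin_poleKernel hs
  have h3 := hasMellin_const_smul h2.1 (C : ℂ)
  have h4 := hasMellin_add h1 h3.1
  rw [h3.2, h2.2] at h4
  rw [← mellin_idealSum hg hs, eq_sub_iff_add_eq]
  rw [smul_eq_mul, mul_one_div] at h4
  rw [← h4.2]
  congr 1
  ext t
  push_cast
  simp

/-- The main term of a smooth sum over ideals is given by the class number formula. -/
theorem mainTerm_eq (hg : IsTestFunction g) {C D : ℝ}
    (h : ∀ t : ℝ, 0 < t → t ≤ 1 → |idealSum K g t - C / t| ≤ D) :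
    C = dedekindZeta_residue K * ∫ t in Set.Ioi 0, g t := by
  obtain ⟨b, hb⟩ := remainder_eq_zero (K := K) hg C
  have hF := (differentiableAt_mellin_of_bounded (continuousOn_remainder hg C) hb
    (norm_remainder_le h) (s := 1) (by simp)).continuousAt
  have hG := (hg.differentiableAt_mellin (s := 1) (by simp)).continuousAt
  have hof : Tendsto (fun s : ℝ ↦ (s : ℂ)) (nhdsWithin 1 (Set.Ioi 1)) (nhds 1) := by
    have := Complex.continuous_ofReal.tendsto 1
    exact (by simpa using this : Tendsto (fun s : ℝ ↦ (s : ℂ)) (nhds 1) (nhds 1)).mono_left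
      nhdsWithin_le_nhds
  -- Multiply by `s - 1` and let `s → 1⁺`: the transform of the remainder stays finite and drops
  -- out, leaving `C` on one side and the residue times `∫ g` on the other.
  have hl1 := (hof.sub_const 1).mul (hF.tendsto.comp hof)
  have hl2 := hl1.add ((tendsto_const_nhds (x := (C : ℂ))).div hof one_ne_zero)
  have hl3 := (hG.tendsto.comp hof).mul (tendsto_sub_one_mul_dedekindZeta_nhdsGT K)
  have hev : (fun s : ℝ ↦ ((s : ℂ) - 1) *
      mellin (fun t ↦ ((idealSum K g t - C * poleKernel t : ℝ) : ℂ)) s + C / s)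
      =ᶠ[nhdsWithin 1 (Set.Ioi 1)]
      fun s : ℝ ↦ mellin (fun t ↦ (g t : ℂ)) s * ((s - 1) * dedekindZeta K s) := by
    filter_upwards [self_mem_nhdsWithin] with s hs
    have hs' : (1 : ℝ) < s := hs
    rw [mellin_remainder hg h (by simpa using hs')]
    have h1 : (s : ℂ) ≠ 0 := by exact_mod_cast (by linarith : s ≠ 0)
    have h2 : (s : ℂ) - 1 ≠ 0 := by
      rw [sub_ne_zero]; exact_mod_cast hs'.ne'
    field_simp
    ring
  have h5 := tendsto_nhds_unique (hl2.congr' hev) hl3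
  rw [IsTestFunction.mellin_one (g := g)] at h5
  simp only [sub_self, zero_mul, zero_add, div_one] at h5
  have h6 : C = (∫ t in Set.Ioi 0, g t) * dedekindZeta_residue K := by exact_mod_cast h5
  rw [h6, mul_comm]

variable (K g) in
/-- A smooth sum over ideals minus its main term. -/
noncomputable def idealSumRemainder (t : ℝ) : ℝ :=
  idealSum K g t - dedekindZeta_residue K * (∫ u in Set.Ioi 0, g u) * poleKernel t

theorem exists_abs_idealSum_sub_residue_le (hg : IsTestFunction g) :
    ∃ D, ∀ t : ℝ, 0 < t → t ≤ 1 →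
      |idealSum K g t - dedekindZeta_residue K * (∫ u in Set.Ioi 0, g u) / t| ≤ D := by
  obtain ⟨C, D, h⟩ := exists_abs_idealSum_sub_le (K := K) hg.contDiff hg.hasCompactSupport
    hg.tsupport_subset
  exact ⟨D, by rwa [← mainTerm_eq hg h]⟩

theorem mellinConvergent_idealSumRemainder (hg : IsTestFunction g) {s : ℂ} (hs : 0 < s.re) :
    MellinConvergent (fun t ↦ (idealSumRemainder K g t : ℂ)) s := by
  obtain ⟨D, h⟩ := exists_abs_idealSum_sub_residue_le (K := K) hg
  obtain ⟨b, hb⟩ := remainder_eq_zero (K := K) hg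
    (dedekindZeta_residue K * ∫ u in Set.Ioi 0, g u)
  exact mellinConvergent_of_bounded (continuousOn_remainder hg _) hb (norm_remainder_le h) hs

theorem differentiableAt_mellin_idealSumRemainder (hg : IsTestFunction g) {s : ℂ}
    (hs : 0 < s.re) : DifferentiableAt ℂ (mellin fun t ↦ (idealSumRemainder K g t : ℂ)) s := by
  obtain ⟨D, h⟩ := exists_abs_idealSum_sub_residue_le (K := K) hg
  obtain ⟨b, hb⟩ := remainder_eq_zero (K := K) hg
    (dedekindZeta_residue K * ∫ u in Set.Ioi 0, g u)
  exact differentiableAt_mellin_of_bounded (continuousOn_remainder hg _) hb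
    (norm_remainder_le h) hs

theorem mellin_idealSumRemainder (hg : IsTestFunction g) {s : ℂ} (hs : 1 < s.re) :
    mellin (fun t ↦ (idealSumRemainder K g t : ℂ)) s =
      mellin (fun t ↦ (g t : ℂ)) s * dedekindZeta K s -
        (dedekindZeta_residue K * ∫ u in Set.Ioi 0, g u : ℝ) / (s * (s - 1)) := by
  obtain ⟨D, h⟩ := exists_abs_idealSum_sub_residue_le (K := K) hg
  exact mellin_remainder hg h hs

variable (K g) in
/-- The analytic continuation of `mellin g * dedekindZeta K` to `0 < re s`, `s ≠ 1`. -/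
noncomputable def mellinMulZeta (s : ℂ) : ℂ :=
  mellin (fun t ↦ (idealSumRemainder K g t : ℂ)) s +
    (dedekindZeta_residue K * ∫ u in Set.Ioi 0, g u : ℝ) / (s * (s - 1))

theorem mellinMulZeta_eq (hg : IsTestFunction g) {s : ℂ} (hs : 1 < s.re) :
    mellinMulZeta K g s = mellin (fun t ↦ (g t : ℂ)) s * dedekindZeta K s := by
  rw [mellinMulZeta, mellin_idealSumRemainder hg hs, sub_add_cancel]

theorem differentiableAt_mellinMulZeta (hg : IsTestFunction g) {s : ℂ} (hs : 0 < s.re)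
    (h1 : s ≠ 1) : DifferentiableAt ℂ (mellinMulZeta K g) s := by
  have hs0 : s ≠ 0 := by rintro rfl; simp at hs
  refine (differentiableAt_mellin_idealSumRemainder hg hs).add
    ((differentiableAt_const _).div (by fun_prop) (mul_ne_zero hs0 (sub_ne_zero.mpr h1)))

theorem mellinMulZeta_conj (s : ℂ) :
    mellinMulZeta K g ((starRingEnd ℂ) s) = (starRingEnd ℂ) (mellinMulZeta K g s) := by
  simp only [mellinMulZeta, mellin_ofReal_conj, map_add, map_div₀, Complex.conj_ofReal, map_mul,
    map_sub, map_one]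

/-- Both sides are zeta times the two Mellin transforms when `1 < Re s`. Multiplying by `s - 1`
removes the pole, and the identity theorem applies on the whole half plane. Hence the quotient
defining `continuedZeta` does not depend on the test function. -/
theorem mellinMulZeta_mul_comm {g₁ g₂ : ℝ → ℝ} (h₁ : IsTestFunction g₁) (h₂ : IsTestFunction g₂)
    {s : ℂ} (hs : 0 < s.re) (hs1 : s ≠ 1) :
    mellinMulZeta K g₁ s * mellin (fun t ↦ (g₂ t : ℂ)) s =
      mellinMulZeta K g₂ s * mellin (fun t ↦ (g₁ t : ℂ)) s := by
  let H : (ℝ → ℝ) → ℂ → ℂ := fun g s ↦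
    (s - 1) * mellin (fun t ↦ (idealSumRemainder K g t : ℂ)) s +
      (dedekindZeta_residue K * ∫ u in Set.Ioi 0, g u : ℝ) / s
  have hH : ∀ g s, 0 < s.re → s ≠ 1 → H g s = (s - 1) * mellinMulZeta K g s := by
    intro g s hs h1
    have hs0 : s ≠ 0 := by rintro rfl; simp at hs
    have h2 := sub_ne_zero.mpr h1
    simp only [H, mellinMulZeta]
    field_simp
  have hopen : IsOpen {s : ℂ | 0 < s.re} := isOpen_lt continuous_const Complex.continuous_re
  have hHd : ∀ g, IsTestFunction g → DifferentiableOn ℂ (H g) {s : ℂ | 0 < s.re} := by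
    intro g hg s hs
    have hs0 : s ≠ 0 := by rintro rfl; simp at hs
    have := differentiableAt_mellin_idealSumRemainder (K := K) hg hs
    exact DifferentiableAt.differentiableWithinAt <|
      (((differentiableAt_id.sub_const 1).mul this).add
        ((differentiableAt_const _).div differentiableAt_id hs0))
  have hMd : ∀ g, IsTestFunction g →
      DifferentiableOn ℂ (mellin fun t ↦ (g t : ℂ)) {s : ℂ | 0 < s.re} := fun g hg s hs ↦
    (hg.differentiableAt_mellin hs).differentiableWithinAt
  have hA := ((hHd g₁ h₁).mul (hMd g₂ h₂)).analyticOnNhd hopen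
  have hB := ((hHd g₂ h₂).mul (hMd g₁ h₁)).analyticOnNhd hopen
  have hconv : Convex ℝ {s : ℂ | 0 < s.re} := convex_halfSpace_re_gt 0
  have heq := hA.eqOn_of_preconnected_of_eventuallyEq hB hconv.isPreconnected (z₀ := 2) (by simp)
    (by
      filter_upwards [(isOpen_lt continuous_const Complex.continuous_re).mem_nhds
        (show (2 : ℂ) ∈ {s : ℂ | 1 < s.re} by simp)] with s hs
      have hs' : 1 < s.re := hs
      have hs1 : s ≠ 1 := by rintro rfl; simp at hs'
      simp only [Pi.mul_apply]
      rw [hH _ s (by linarith) hs1, hH _ s (by linarith) hs1, mellinMulZeta_eq h₁ hs',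
        mellinMulZeta_eq h₂ hs']
      ring)
  have h := heq hs
  simp only [Pi.mul_apply] at h
  rw [hH _ s hs hs1, hH _ s hs hs1, mul_assoc, mul_assoc] at h
  exact mul_left_cancel₀ (sub_ne_zero.mpr hs1) h

variable (K) in
/-- The analytic continuation of the Dedekind zeta function to `0 < re s`, `s ≠ 1`. -/
noncomputable def continuedZeta (s : ℂ) : ℂ :=
  mellinMulZeta K (exists_isTestFunction_mellin_ne_zero s).choose s /
    mellin (fun t ↦ ((exists_isTestFunction_mellin_ne_zero s).choose t : ℂ)) s

theorem mellin_mul_continuedZeta (hg : IsTestFunction g) {s : ℂ} (hs : 0 < s.re) (h1 : s ≠ 1) :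
    mellin (fun t ↦ (g t : ℂ)) s * continuedZeta K s = mellinMulZeta K g s := by
  obtain ⟨h2, h3⟩ := (exists_isTestFunction_mellin_ne_zero s).choose_spec
  rw [continuedZeta, mul_div_assoc', div_eq_iff h3, mellinMulZeta_mul_comm hg h2 hs h1, mul_comm]

theorem continuedZeta_eq (s : ℂ) (hs : 1 < s.re) : continuedZeta K s = dedekindZeta K s := by
  obtain ⟨h2, h3⟩ := (exists_isTestFunction_mellin_ne_zero s).choose_spec
  rw [continuedZeta, mellinMulZeta_eq h2 hs, mul_div_cancel_left₀ _ h3]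

/-- The definition chooses a test function separately at each point, but one whose transform is
nonzero at `s` serves throughout a neighbourhood of `s`. -/
theorem analyticAt_continuedZeta {s : ℂ} (hs : 0 < s.re) (h1 : s ≠ 1) :
    AnalyticAt ℂ (continuedZeta K) s := by
  obtain ⟨g, hg, hgs⟩ := exists_isTestFunction_mellin_ne_zero s
  have hre : ∀ᶠ z in nhds s, 0 < z.re :=
    (isOpen_lt continuous_const Complex.continuous_re).mem_nhds hs
  have hne : ∀ᶠ z in nhds s, z ≠ 1 := isOpen_ne.mem_nhds h1
  have hM : AnalyticAt ℂ (mellinMulZeta K g) s := by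
    rw [Complex.analyticAt_iff_eventually_differentiableAt]
    filter_upwards [hre, hne] with z hz hz1 using differentiableAt_mellinMulZeta hg hz hz1
  have hG : AnalyticAt ℂ (mellin fun t ↦ (g t : ℂ)) s := by
    rw [Complex.analyticAt_iff_eventually_differentiableAt]
    filter_upwards [hre] with z hz using hg.differentiableAt_mellin hz
  refine (hM.div hG hgs).congr ?_
  filter_upwards [hre, hne, hG.continuousAt.eventually_ne hgs] with z hz hz1 hzg
  rw [Pi.div_apply, div_eq_iff hzg, mul_comm, mellin_mul_continuedZeta hg hz hz1]

variable (K) in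
theorem isDedekindZetaContinuation_continuedZeta :
    IsDedekindZetaContinuation K (continuedZeta K) :=
  ⟨fun s hs ↦ analyticAt_continuedZeta (by linarith [hs.1] : 0 < s.re) hs.2, continuedZeta_eq⟩

theorem continuedZeta_conj {s : ℂ} (hs : 0 < s.re) (h1 : s ≠ 1) :
    continuedZeta K ((starRingEnd ℂ) s) = (starRingEnd ℂ) (continuedZeta K s) := by
  obtain ⟨g, hg, hgs⟩ := exists_isTestFunction_mellin_ne_zero s
  have h2 := mellin_mul_continuedZeta (K := K) hg (s := (starRingEnd ℂ) s) (by simpa using hs)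
    (fun h ↦ h1 (by simpa using congrArg (starRingEnd ℂ) h))
  rw [mellin_ofReal_conj, mellinMulZeta_conj, ← mellin_mul_continuedZeta hg hs h1, map_mul] at h2
  exact mul_left_cancel₀ ((map_ne_zero _).mpr hgs) h2

/-- Under the extended Lindelöf hypothesis, the zeta function grows slower than any power on the
critical line. -/
theorem ExtendedLindelofHypothesis.exists_norm_continuedZeta_le
    (hELH : ExtendedLindelofHypothesis K) {ε : ℝ} (hε : 0 < ε) :
    ∃ A, 0 ≤ A ∧ ∀ T : ℝ,
      ‖continuedZeta K (((1 / 2 : ℝ) : ℂ) + T * Complex.I)‖ ≤ A * (1 + |T|) ^ ε := by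
  have hre : ∀ T : ℝ, 0 < (((1 / 2 : ℝ) : ℂ) + T * Complex.I).re := fun T ↦ by simp
  have hne : ∀ T : ℝ, ((1 / 2 : ℝ) : ℂ) + T * Complex.I ≠ 1 := fun T h ↦ by
    have := congrArg Complex.re h
    norm_num at this
  have h1 := hELH _ (isDedekindZetaContinuation_continuedZeta K) (1 / 2) le_rfl ε hε
  obtain ⟨c, hc⟩ := h1.bound
  obtain ⟨T₀, hT₀⟩ := eventually_atTop.mp hc
  have hcont : Continuous fun T : ℝ ↦ continuedZeta K (((1 / 2 : ℝ) : ℂ) + T * Complex.I) := by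
    rw [continuous_iff_continuousAt]
    intro T
    exact ContinuousAt.comp (f := fun T : ℝ ↦ ((1 / 2 : ℝ) : ℂ) + T * Complex.I)
      (analyticAt_continuedZeta (hre T) (hne T)).continuousAt (by fun_prop)
  -- The hypothesis speaks only of `T → +∞`: bounded `T ≥ 0` is handled by compactness, negative `T`
  -- by conjugation.
  obtain ⟨B, hB⟩ := (isCompact_Icc (a := (0 : ℝ)) (b := max T₀ 0)).exists_bound_of_continuousOn
    hcont.continuousOn
  have hB0 : 0 ≤ B := (norm_nonneg _).trans (hB 0 ⟨le_rfl, le_max_right _ _⟩)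
  have hpos : ∀ T : ℝ, 0 ≤ T →
      ‖continuedZeta K (((1 / 2 : ℝ) : ℂ) + T * Complex.I)‖ ≤ (B + |c|) * (1 + |T|) ^ ε := by
    intro T hT
    have h1T : (1 : ℝ) ≤ (1 + |T|) ^ ε := Real.one_le_rpow (by linarith [abs_nonneg T]) hε.le
    rw [add_mul]
    rcases le_total T (max T₀ 0) with h | h
    · have := hB T ⟨hT, h⟩
      nlinarith [abs_nonneg c, mul_nonneg (abs_nonneg c) (zero_le_one.trans h1T)]
    · have h2 := hT₀ T ((le_max_left _ _).trans h)
      have h3 : ‖T ^ ε‖ ≤ (1 + |T|) ^ ε := by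
        rw [Real.norm_eq_abs, abs_of_nonneg (Real.rpow_nonneg hT _)]
        exact Real.rpow_le_rpow hT (by linarith [le_abs_self T]) hε.le
      calc _ ≤ c * ‖T ^ ε‖ := h2
        _ ≤ |c| * (1 + |T|) ^ ε :=
          mul_le_mul (le_abs_self c) h3 (norm_nonneg _) (abs_nonneg c)
        _ ≤ _ := le_add_of_nonneg_left (by positivity)
  refine ⟨B + |c|, by positivity, fun T ↦ ?_⟩
  rcases le_total 0 T with h | h
  · exact hpos T h
  · have h2 := hpos (-T) (by linarith)
    rw [abs_neg] at h2
    have h3 : (((1 / 2 : ℝ) : ℂ) + T * Complex.I) =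
        (starRingEnd ℂ) (((1 / 2 : ℝ) : ℂ) + (-T : ℝ) * Complex.I) := by
      simp only [map_add, map_mul, Complex.conj_ofReal, Complex.conj_I]
      push_cast
      ring
    rw [h3, continuedZeta_conj (hre _) (hne _), RCLike.norm_conj]
    exact h2

end Continuation

/-! ### Decay of Mellin transforms through derivatives -/

namespace IsTestFunction

variable {g : ℝ → ℝ}

theorem deriv (hg : IsTestFunction g) : IsTestFunction (deriv g) where
  contDiff := ((contDiff_succ_iff_deriv (n := (⊤ : ℕ∞))).mp (by simpa using hg.contDiff)).2.2
  hasCompactSupport := hg.hasCompactSupport.deriv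
  tsupport_subset := (tsupport_deriv_subset ..).trans hg.tsupport_subset

/-- Integration by parts; both boundary terms vanish because the support is compact in `(0, ∞)`. -/
theorem mellin_deriv (hg : IsTestFunction g) {s : ℂ} (hs : 0 < s.re) :
    mellin (fun t ↦ ((_root_.deriv g t : ℝ) : ℂ)) (s + 1) =
      -s * mellin (fun t ↦ (g t : ℂ)) s := by
  have hs0 : s ≠ 0 := by rintro rfl; simp at hs
  have hd : Differentiable ℝ g := hg.contDiff.differentiable (by simp)
  have hu : ∀ t ∈ Set.Ioi (0 : ℝ), HasDerivAt (fun t : ℝ ↦ (t : ℂ) ^ s)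
      (s * (t : ℂ) ^ (s - 1)) t := fun t ht ↦ by
    have h1 := (hasDerivAt_ofReal_cpow_const' (ne_of_gt ht) (r := s - 1)
      (by intro h; exact hs0 (by linear_combination h))).const_mul s
    simp only [sub_add_cancel] at h1
    exact h1.congr_of_eventuallyEq (Eventually.of_forall fun y ↦ by field_simp)
  have hv : ∀ t ∈ Set.Ioi (0 : ℝ), HasDerivAt (fun t : ℝ ↦ (g t : ℂ))
      ((_root_.deriv g t : ℝ) : ℂ) t := fun t _ ↦ (hd t).hasDerivAt.ofReal_comp
  have h1 := hg.deriv.mellinConvergent (s := s + 1) (by simp; linarith)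
  have h2 := (hg.mellinConvergent hs).const_mul s
  simp only [add_sub_cancel_right, smul_eq_mul, MellinConvergent] at h1
  obtain ⟨b, -, hb⟩ := exists_forall_lt_eq_zero hg.hasCompactSupport
  have h3 := MeasureTheory.integral_Ioi_mul_deriv_eq_deriv_mul (a' := 0) (b' := 0) hu hv h1
    (by simpa only [Pi.mul_def, smul_eq_mul, mul_assoc, MeasureTheory.IntegrableOn] using h2)
    (by
      have h0 : (0 : ℝ) ∉ tsupport g := fun h ↦ lt_irrefl (0 : ℝ) (hg.tsupport_subset h)
      refine tendsto_const_nhds.congr' ?_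
      filter_upwards [nhdsWithin_le_nhds (notMem_tsupport_iff_eventuallyEq.mp h0)] with t ht
      simp [ht])
    (by
      refine tendsto_const_nhds.congr' ?_
      filter_upwards [eventually_gt_atTop b] with t ht
      simp [hb t ht])
  simp only [mellin, add_sub_cancel_right, smul_eq_mul]
  rw [h3, sub_zero, zero_sub, neg_mul, ← MeasureTheory.integral_const_mul]
  simp only [mul_assoc]

theorem integrable_abs (hg : IsTestFunction g) : MeasureTheory.Integrable fun t ↦ |g t| :=
  (hg.contDiff.continuous.integrable_of_hasCompactSupport hg.hasCompactSupport).abs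

/-- For `1 ≤ Re s` the weight `t ^ (Re s - 1)` is largest at the right end of the support. On the
critical line the bound is reached after differentiation, which shifts `s` by `1` or `2`. -/
theorem norm_mellin_le (hg : IsTestFunction g) {s : ℂ} (hs : 1 ≤ s.re) {b : ℝ} (hb0 : 0 ≤ b)
    (hb : ∀ t, b < t → g t = 0) :
    ‖mellin (fun t ↦ (g t : ℂ)) s‖ ≤ b ^ (s.re - 1) * ∫ t, |g t| := by
  rw [mellin, ← MeasureTheory.integral_const_mul]
  refine (MeasureTheory.norm_integral_le_of_norm_le
    (hg.integrable_abs.const_mul (b ^ (s.re - 1))).integrableOn ?_).trans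
    (MeasureTheory.setIntegral_le_integral (hg.integrable_abs.const_mul _)
      (Eventually.of_forall fun t ↦ by positivity))
  refine (MeasureTheory.ae_restrict_mem measurableSet_Ioi).mono fun t ht ↦ ?_
  rw [norm_smul, Complex.norm_cpow_eq_rpow_re_of_pos ht, Complex.norm_real, Real.norm_eq_abs]
  by_cases h : b < t
  · simp [hb t h]
  · have := Set.mem_Ioi.mp ht
    simp only [Complex.sub_re, Complex.one_re]
    gcongr
    linarith

theorem deriv_eq_zero {b : ℝ} (hb : ∀ t, b < t → g t = 0) (t : ℝ) (ht : b < t) :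
    _root_.deriv g t = 0 := by
  have : g =ᶠ[nhds t] fun _ ↦ 0 := by
    filter_upwards [eventually_gt_nhds ht] with u hu using hb u hu
  rw [this.deriv_eq]; simp

end IsTestFunction

theorem one_add_abs_le_three_mul_norm {s : ℂ} (hs : 1 / 2 ≤ s.re) : 1 + |s.im| ≤ 3 * ‖s‖ := by
  have h1 : ‖s‖ ^ 2 = s.re ^ 2 + s.im ^ 2 := by
    rw [← Complex.normSq_eq_norm_sq, Complex.normSq_apply]; ring
  refine abs_le_of_sq_le_sq' ?_ (by positivity) |>.2
  nlinarith [sq_abs s.im, sq_nonneg (|s.im| - 1)]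

namespace IsTestFunction

variable {g : ℝ → ℝ}

theorem norm_mellin_mul_le (hg : IsTestFunction g) (hb : ∀ t, 4 < t → g t = 0) (T : ℝ) :
    ‖mellin (fun t ↦ (g t : ℂ)) (((1 / 2 : ℝ) : ℂ) + T * Complex.I)‖ * (1 + |T|) ≤
      6 * ∫ t, |_root_.deriv g t| := by
  set s : ℂ := ((1 / 2 : ℝ) : ℂ) + T * Complex.I
  have hre : s.re = 1 / 2 := by simp [s]
  have him : s.im = T := by simp [s]
  have h1 := congrArg norm (hg.mellin_deriv (s := s) (by rw [hre]; norm_num))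
  rw [norm_mul, norm_neg] at h1
  have h2 := hg.deriv.norm_mellin_le (s := s + 1) (by simp [hre]) (by norm_num) (deriv_eq_zero hb)
  have h3 := one_add_abs_le_three_mul_norm hre.ge
  -- The `6` is this `4 ^ (1/2) = 2` times the `3` of `one_add_abs_le_three_mul_norm`.
  have h4 : (4 : ℝ) ^ ((s + 1).re - 1) = 2 := by
    rw [show (4 : ℝ) = 2 ^ (2 : ℝ) by norm_num, ← Real.rpow_mul (by norm_num)]
    simp [hre]
  rw [him] at h3
  rw [h1, h4] at h2
  nlinarith [norm_nonneg (mellin (fun t ↦ (g t : ℂ)) s)]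

theorem norm_mellin_mul_sq_le (hg : IsTestFunction g) (hb : ∀ t, 4 < t → g t = 0) (T : ℝ) :
    ‖mellin (fun t ↦ (g t : ℂ)) (((1 / 2 : ℝ) : ℂ) + T * Complex.I)‖ * (1 + |T|) ^ 2 ≤
      72 * ∫ t, |_root_.deriv (_root_.deriv g) t| := by
  set s : ℂ := ((1 / 2 : ℝ) : ℂ) + T * Complex.I
  have hre : s.re = 1 / 2 := by simp [s]
  have him : s.im = T := by simp [s]
  have h1 := congrArg norm (hg.mellin_deriv (s := s) (by rw [hre]; norm_num))
  have h1' := congrArg norm (hg.deriv.mellin_deriv (s := s + 1)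
    (by simp only [Complex.add_re, hre, Complex.one_re]; norm_num))
  rw [norm_mul, norm_neg] at h1 h1'
  have h2 := hg.deriv.deriv.norm_mellin_le (s := s + 1 + 1)
    (by simp only [Complex.add_re, hre, Complex.one_re]; norm_num) (by norm_num)
    (deriv_eq_zero (deriv_eq_zero hb))
  have h3 := one_add_abs_le_three_mul_norm hre.ge
  have h3' := one_add_abs_le_three_mul_norm (s := s + 1)
    (by simp only [Complex.add_re, hre, Complex.one_re]; norm_num)
  -- The `72` is this `4 ^ (3/2) = 8` times `3 ^ 2`.
  have h4 : (4 : ℝ) ^ ((s + 1 + 1).re - 1) = 8 := by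
    rw [show (4 : ℝ) = 2 ^ (2 : ℝ) by norm_num, ← Real.rpow_mul (by norm_num)]
    rw [show 2 * ((s + 1 + 1).re - 1) = (3 : ℕ) by simp [hre]; norm_num, Real.rpow_natCast]
    norm_num
  have h5 : (s + 1).im = T := by simp [him]
  rw [him] at h3
  rw [h5] at h3'
  rw [h1', h1, h4] at h2
  have h6 : (1 + |T|) ^ 2 ≤ 9 * (‖s + 1‖ * ‖s‖) := by
    have := mul_le_mul h3 h3' (by positivity) (by positivity)
    nlinarith
  nlinarith [mul_le_mul_of_nonneg_left h6 (norm_nonneg (mellin (fun t ↦ (g t : ℂ)) s))]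

/-- Interpolation between the two bounds obtained by integrating by parts once and twice. -/
theorem norm_mellin_le_rpow (hg : IsTestFunction g) (hb : ∀ t, 4 < t → g t = 0) {B δ η : ℝ}
    (hδ : 0 < δ) (hη : 0 ≤ η) (hη1 : η ≤ 1) (h1 : ∫ t, |_root_.deriv g t| ≤ B)
    (h2 : ∫ t, |_root_.deriv (_root_.deriv g) t| ≤ B / δ) (T : ℝ) :
    ‖mellin (fun t ↦ (g t : ℂ)) (((1 / 2 : ℝ) : ℂ) + T * Complex.I)‖ ≤
      72 * B * δ ^ (-η) * (1 + |T|) ^ (-1 - η) := by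
  have hT : 0 < 1 + |T| := by positivity
  have e1 := hg.norm_mellin_mul_le hb T
  have e2 := hg.norm_mellin_mul_sq_le hb T
  set m := ‖mellin (fun t ↦ (g t : ℂ)) (((1 / 2 : ℝ) : ℂ) + T * Complex.I)‖
  have hB : 0 ≤ B := le_trans (MeasureTheory.integral_nonneg fun _ ↦ abs_nonneg _) h1
  set u := 1 + |T|
  -- The two bounds amount to `B * u⁻¹ * min 1 (δ * u)⁻¹` up to constants, and that minimum is at
  -- most `(δ * u) ^ (-η)` for `0 ≤ η ≤ 1`.
  have hw : δ ^ (-η) * u ^ (-1 - η) = u⁻¹ * (δ * u) ^ (-η) := by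
    rw [Real.mul_rpow hδ.le hT.le, sub_eq_add_neg, Real.rpow_add hT, Real.rpow_neg_one]; ring
  rw [mul_assoc, hw]
  have hδu : 0 < δ * u := by positivity
  rcases le_or_gt 1 (δ * u) with h | h
  · have h3 : (δ * u)⁻¹ ≤ (δ * u) ^ (-η) := by
      rw [← Real.rpow_neg_one]
      exact Real.rpow_le_rpow_of_exponent_le h (by linarith)
    calc m ≤ 72 * (B / δ) / u ^ 2 := by rw [le_div_iff₀ (by positivity)]; linarith
      _ = 72 * B * (u⁻¹ * (δ * u)⁻¹) := by field_simp
      _ ≤ _ := by gcongr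
  · have h3 : 1 ≤ (δ * u) ^ (-η) := Real.one_le_rpow_of_pos_of_le_one_of_nonpos hδu h.le (by linarith)
    calc m ≤ 6 * B / u := by rw [le_div_iff₀ (by positivity)]; linarith
      _ = 6 * B * (u⁻¹ * 1) := by field_simp
      _ ≤ _ := by gcongr; norm_num

end IsTestFunction

/-! ### Mellin inversion on the critical line -/

section Remainder

variable {K : Type*} [Field K] [NumberField K]

theorem norm_div_mul_sub_one_le (c : ℂ) (T : ℝ) :
    ‖c / ((((1 / 2 : ℝ) : ℂ) + T * Complex.I) * (((1 / 2 : ℝ) : ℂ) + T * Complex.I - 1))‖ ≤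
      9 * ‖c‖ / (1 + |T|) ^ 2 := by
  set s : ℂ := ((1 / 2 : ℝ) : ℂ) + T * Complex.I
  have h1 : 1 + |T| ≤ 3 * ‖s‖ := by
    simpa [s] using one_add_abs_le_three_mul_norm (s := s) (by simp [s])
  -- On `Re s = 1/2`, the points `0` and `1` are equidistant from `s`.
  have h2 : ‖s - 1‖ = ‖s‖ := by
    have : s - 1 = -(starRingEnd ℂ) s := by
      apply Complex.ext
      · simp [s]; norm_num
      · simp [s]
    rw [this, norm_neg, RCLike.norm_conj]
  have h0 : 0 < 1 + |T| := by positivity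
  have h3 : 0 < ‖s‖ := by linarith
  rw [norm_div, norm_mul, h2, div_le_div_iff₀ (by positivity) (by positivity)]
  have h4 : (1 + |T|) ^ 2 ≤ (3 * ‖s‖) ^ 2 := by gcongr
  nlinarith [norm_nonneg c]

/-- Interpolation with `η = 2 * ε` gives decay of exponent `-1 - 2 * ε`; the zeta factor costs `ε`,
and what remains is still integrable. -/
theorem norm_mellin_idealSumRemainder_le {A B δ ε : ℝ} {g : ℝ → ℝ} (hg : IsTestFunction g)
    (hb : ∀ t, 4 < t → g t = 0) (hε : 0 < ε) (hε1 : 2 * ε ≤ 1) (hA0 : 0 ≤ A)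
    (hA : ∀ T : ℝ, ‖continuedZeta K (((1 / 2 : ℝ) : ℂ) + T * Complex.I)‖ ≤ A * (1 + |T|) ^ ε)
    (hδ : 0 < δ) (h1 : ∫ t, |deriv g t| ≤ B) (h2 : ∫ t, |deriv (deriv g) t| ≤ B / δ) (T : ℝ) :
    ‖mellin (fun t ↦ (idealSumRemainder K g t : ℂ)) (((1 / 2 : ℝ) : ℂ) + T * Complex.I)‖ ≤
      (72 * A + 9) * (B * δ ^ (-(2 * ε)) + |dedekindZeta_residue K * ∫ u in Set.Ioi 0, g u|) *
        (1 + |T|) ^ (-(1 + ε)) := by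
  set s : ℂ := ((1 / 2 : ℝ) : ℂ) + T * Complex.I with hs
  have hre : s.re = 1 / 2 := by simp [s]
  have hs1 : s ≠ 1 := by intro h; rw [h] at hre; norm_num at hre
  have hB : 0 ≤ B := le_trans (MeasureTheory.integral_nonneg fun _ ↦ abs_nonneg _) h1
  have hT : 1 ≤ 1 + |T| := by simp
  have hT0 : 0 < 1 + |T| := by positivity
  have e1 : mellin (fun t ↦ (idealSumRemainder K g t : ℂ)) s =
      mellin (fun t ↦ (g t : ℂ)) s * continuedZeta K s -
        (dedekindZeta_residue K * ∫ u in Set.Ioi 0, g u : ℝ) / (s * (s - 1)) := by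
    rw [mellin_mul_continuedZeta hg (by rw [hre]; norm_num) hs1, mellinMulZeta]; ring
  have e2 := norm_div_mul_sub_one_le
    ((dedekindZeta_residue K * ∫ u in Set.Ioi 0, g u : ℝ) : ℂ) T
  rw [Complex.norm_real, Real.norm_eq_abs, ← hs] at e2
  set C := dedekindZeta_residue K * ∫ u in Set.Ioi 0, g u
  have e3 := hg.norm_mellin_le_rpow hb hδ (by linarith) hε1 h1 h2 T
  have e4 := hA T
  rw [← hs] at e3 e4
  have e5 : 9 * |C| / (1 + |T|) ^ 2 ≤ 9 * |C| * (1 + |T|) ^ (-(1 + ε)) := by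
    rw [div_eq_mul_inv, ← Real.rpow_natCast, ← Real.rpow_neg hT0.le]
    gcongr
    push_cast; linarith
  have e6 : (1 + |T|) ^ (-1 - 2 * ε) * (1 + |T|) ^ ε = (1 + |T|) ^ (-(1 + ε)) := by
    rw [← Real.rpow_add hT0]; ring_nf
  rw [e1]
  calc _ ≤ ‖mellin (fun t ↦ (g t : ℂ)) s‖ * ‖continuedZeta K s‖ + 9 * |C| / (1 + |T|) ^ 2 := by
        rw [← norm_mul]; exact (norm_sub_le _ _).trans (add_le_add_right e2 _)
    _ ≤ (72 * B * δ ^ (-(2 * ε)) * (1 + |T|) ^ (-1 - 2 * ε)) * (A * (1 + |T|) ^ ε) +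
        9 * |C| * (1 + |T|) ^ (-(1 + ε)) := by gcongr
    _ = (72 * A * (B * δ ^ (-(2 * ε))) + 9 * |C|) * (1 + |T|) ^ (-(1 + ε)) := by
        rw [← e6]; ring
    _ ≤ _ := by
        gcongr
        have : 0 ≤ B * δ ^ (-(2 * ε)) := by positivity
        nlinarith [mul_nonneg hA0 (abs_nonneg C)]

/-- Under the Lindelöf hypothesis, smooth sums over ideals have square root error terms, with a
dependence on the smooth weight that is controlled by its first two derivatives. -/
theorem ExtendedLindelofHypothesis.exists_abs_idealSumRemainder_le
    (hELH : ExtendedLindelofHypothesis K) {ε : ℝ} (hε : 0 < ε) (hε1 : 2 * ε ≤ 1) :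
    ∃ A, 0 ≤ A ∧ ∀ g : ℝ → ℝ, IsTestFunction g → (∀ t, 4 < t → g t = 0) → ∀ B δ : ℝ, 0 < δ →
      ∫ t, |deriv g t| ≤ B → ∫ t, |deriv (deriv g) t| ≤ B / δ → ∀ t : ℝ, 0 < t →
        |idealSumRemainder K g t| ≤
          A * (B * δ ^ (-(2 * ε)) + |dedekindZeta_residue K * ∫ u in Set.Ioi 0, g u|) *
            t ^ (-(1 / 2 : ℝ)) := by
  obtain ⟨A, hA0, hA⟩ := hELH.exists_norm_continuedZeta_le hε
  have hI : MeasureTheory.Integrable fun T : ℝ ↦ (1 + |T|) ^ (-(1 + ε)) :=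
    integrable_one_add_norm (E := ℝ) (by simpa using hε)
  have hI0 : 0 ≤ ∫ T : ℝ, (1 + |T|) ^ (-(1 + ε)) :=
    MeasureTheory.integral_nonneg fun T ↦ by positivity
  refine ⟨1 / (2 * π) * ((72 * A + 9) * ∫ T : ℝ, (1 + |T|) ^ (-(1 + ε))),
    by have := Real.pi_pos; positivity, fun g hg hb B δ hδ h1 h2 t ht ↦ ?_⟩
  have hbd := norm_mellin_idealSumRemainder_le hg hb hε hε1 hA0 hA hδ h1 h2
  set D := B * δ ^ (-(2 * ε)) + |dedekindZeta_residue K * ∫ u in Set.Ioi 0, g u|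
  have hcont : Continuous fun T : ℝ ↦ mellin (fun t ↦ (idealSumRemainder K g t : ℂ))
      (((1 / 2 : ℝ) : ℂ) + T * Complex.I) := by
    refine continuous_iff_continuousAt.mpr fun T ↦ ?_
    exact ContinuousAt.comp (f := fun T : ℝ ↦ ((1 / 2 : ℝ) : ℂ) + T * Complex.I)
      (differentiableAt_mellin_idealSumRemainder hg (by simp)).continuousAt (by fun_prop)
  have hv : Complex.VerticalIntegrable (mellin fun t ↦ (idealSumRemainder K g t : ℂ))
      (1 / 2 : ℝ) :=
    (hI.const_mul ((72 * A + 9) * D)).mono' hcont.aestronglyMeasurable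
      (Eventually.of_forall hbd)
  -- No contour is shifted: with the pole already subtracted, the Mellin integral itself converges
  -- at `1/2`.
  have hinv := mellinInv_mellin_eq (1 / 2) (fun t ↦ (idealSumRemainder K g t : ℂ)) ht
    (mellinConvergent_idealSumRemainder hg (by simp)) hv
    ((continuousOn_remainder hg _).continuousAt (Ioi_mem_nhds ht))
  rw [← Real.norm_eq_abs, ← Complex.norm_real, ← hinv, mellinInv, norm_smul]
  have hpi : ‖(1 / (2 * π) : ℂ)‖ = 1 / (2 * π) := by
    rw [norm_div, norm_mul]; simp [abs_of_pos Real.pi_pos]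
  calc _ ≤ 1 / (2 * π) * ∫ T : ℝ, t ^ (-(1 / 2 : ℝ)) * ((72 * A + 9) * D *
        (1 + |T|) ^ (-(1 + ε))) := by
        refine mul_le_mul (by simp [abs_of_pos Real.pi_pos])
          (MeasureTheory.norm_integral_le_of_norm_le ((hI.const_mul _).const_mul _)
            (Eventually.of_forall fun T ↦ ?_)) (norm_nonneg _)
            (by have := Real.pi_pos; positivity)
        rw [norm_smul, Complex.norm_cpow_eq_rpow_re_of_pos ht]
        refine mul_le_mul (by simp) (hbd T) (norm_nonneg _) (by positivity)
    _ = _ := by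
        rw [MeasureTheory.integral_const_mul, MeasureTheory.integral_const_mul]; ring

end Remainder

/-! ### The smooth cutoff and its dyadic pieces -/

/-- A smooth cutoff equal to `1` on `(-∞, 1]` and to `0` on `[1 + δ, ∞)`. -/
noncomputable def smoothCutoff (δ t : ℝ) : ℝ := 1 - Real.smoothTransition (δ⁻¹ * t - δ⁻¹)

/-- A smooth bump equal to `1` on `[(1 + δ) / 2, 1]` and vanishing outside `[1 / 2, 1 + δ]`. -/
noncomputable def dyadicBump (δ t : ℝ) : ℝ := smoothCutoff δ t - smoothCutoff δ (2 * t)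

section Bump

variable {δ : ℝ}

theorem smoothCutoff_of_le_one (hδ : 0 < δ) {t : ℝ} (ht : t ≤ 1) : smoothCutoff δ t = 1 := by
  rw [smoothCutoff, Real.smoothTransition.zero_of_nonpos, sub_zero]
  have := inv_pos.mpr hδ
  nlinarith

theorem smoothCutoff_of_le (hδ : 0 < δ) {t : ℝ} (ht : 1 + δ ≤ t) : smoothCutoff δ t = 0 := by
  rw [smoothCutoff, Real.smoothTransition.one_of_one_le, sub_self]
  have h1 := inv_pos.mpr hδ
  have h2 : δ⁻¹ * δ = 1 := inv_mul_cancel₀ hδ.ne'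
  nlinarith

theorem smoothCutoff_nonneg (t : ℝ) : 0 ≤ smoothCutoff δ t :=
  sub_nonneg.mpr (Real.smoothTransition.le_one _)

theorem smoothCutoff_le_one (t : ℝ) : smoothCutoff δ t ≤ 1 :=
  sub_le_self _ (Real.smoothTransition.nonneg _)

theorem contDiff_smoothCutoff : ContDiff ℝ (⊤ : ℕ∞) (smoothCutoff δ) :=
  contDiff_const.sub (Real.smoothTransition.contDiff.comp (by fun_prop))

theorem isTestFunction_dyadicBump (hδ : 0 < δ) : IsTestFunction (dyadicBump δ) := by
  have h0 : ∀ t ∉ Set.Icc (1 / 2) (1 + δ), dyadicBump δ t = 0 := fun t ht ↦ by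
    rw [Set.mem_Icc, not_and_or, not_le, not_le] at ht
    rcases ht with ht | ht
    · rw [dyadicBump, smoothCutoff_of_le_one hδ (by linarith),
        smoothCutoff_of_le_one hδ (by linarith), sub_self]
    · rw [dyadicBump, smoothCutoff_of_le hδ (by linarith),
        smoothCutoff_of_le hδ (by linarith), sub_self]
  refine ⟨contDiff_smoothCutoff.sub (contDiff_smoothCutoff.comp (by fun_prop)),
    HasCompactSupport.intro isCompact_Icc h0, ?_⟩
  refine (closure_minimal (Function.support_subset_iff'.mpr h0) isClosed_Icc).trans fun t ht ↦ ?_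
  exact lt_of_lt_of_le (by norm_num) ht.1

theorem dyadicBump_eq_zero (hδ : 0 < δ) (hδ1 : δ ≤ 1) (t : ℝ) (ht : 4 < t) :
    dyadicBump δ t = 0 := by
  rw [dyadicBump, smoothCutoff_of_le hδ (by linarith), smoothCutoff_of_le hδ (by linarith),
    sub_self]

theorem integrable_abs_comp_mul_sub {f : ℝ → ℝ} (hf : MeasureTheory.Integrable f) {a b : ℝ}
    (ha : 0 < a) : MeasureTheory.Integrable fun t ↦ |f (a * t - b)| :=
  ((hf.comp_sub_right b).comp_mul_left' ha.ne').abs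

theorem integral_abs_comp_mul_sub (f : ℝ → ℝ) {a : ℝ} (ha : 0 < a) (b : ℝ) :
    ∫ t, |f (a * t - b)| = a⁻¹ * ∫ t, |f t| := by
  rw [MeasureTheory.Measure.integral_comp_mul_left (fun u ↦ |f (u - b)|) a,
    MeasureTheory.integral_sub_right_eq_self (fun u ↦ |f u|) b, abs_of_pos (inv_pos.mpr ha),
    smul_eq_mul]

theorem deriv_comp_mul_sub {f : ℝ → ℝ} (hf : Differentiable ℝ f) (a b : ℝ) :
    deriv (fun t ↦ f (a * t - b)) = fun t ↦ a * deriv f (a * t - b) := by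
  funext t
  have h1 : HasDerivAt (fun t : ℝ ↦ a * t - b) a t := by
    simpa using ((hasDerivAt_id t).const_mul a).sub_const b
  have h2 : HasDerivAt (fun t ↦ f (a * t - b)) (deriv f (a * t - b) * a) t :=
    (hf _).hasDerivAt.comp t h1
  rw [h2.deriv, mul_comm]

theorem dyadicBump_eq : dyadicBump δ = fun t ↦ Real.smoothTransition (2 * δ⁻¹ * t - δ⁻¹) -
    Real.smoothTransition (δ⁻¹ * t - δ⁻¹) := by
  funext t
  rw [dyadicBump, smoothCutoff, smoothCutoff, show δ⁻¹ * (2 * t) = 2 * δ⁻¹ * t by ring]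
  ring

/-- The derivatives of a difference of two affine rescalings. -/
theorem deriv_sub_comp_mul_sub {f : ℝ → ℝ} (hf : Differentiable ℝ f) (a₁ a₂ b c₁ c₂ : ℝ) :
    deriv (fun t ↦ c₁ * f (a₁ * t - b) - c₂ * f (a₂ * t - b)) =
      fun t ↦ c₁ * a₁ * deriv f (a₁ * t - b) - c₂ * a₂ * deriv f (a₂ * t - b) := by
  funext t
  have h : ∀ a, Differentiable ℝ fun t ↦ f (a * t - b) := fun a ↦ hf.comp (by fun_prop)
  rw [deriv_fun_sub ((h a₁ t).const_mul c₁) ((h a₂ t).const_mul c₂),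
    deriv_const_mul c₁ (h a₁ t), deriv_const_mul c₂ (h a₂ t), deriv_comp_mul_sub hf,
    deriv_comp_mul_sub hf]
  ring

theorem integral_abs_sub_comp_mul_sub_le {f : ℝ → ℝ} (hf : MeasureTheory.Integrable f)
    {a₁ a₂ c₁ c₂ : ℝ} (h₁ : 0 < a₁) (h₂ : 0 < a₂) (hc₁ : 0 ≤ c₁) (hc₂ : 0 ≤ c₂) (b : ℝ) :
    ∫ t, |c₁ * f (a₁ * t - b) - c₂ * f (a₂ * t - b)| ≤
      (c₁ * a₁⁻¹ + c₂ * a₂⁻¹) * ∫ t, |f t| := by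
  have i₁ := (integrable_abs_comp_mul_sub hf h₁ (b := b)).const_mul c₁
  have i₂ := (integrable_abs_comp_mul_sub hf h₂ (b := b)).const_mul c₂
  calc _ ≤ ∫ t, (c₁ * |f (a₁ * t - b)| + c₂ * |f (a₂ * t - b)|) := by
        refine MeasureTheory.integral_mono_of_nonneg (Eventually.of_forall fun _ ↦ abs_nonneg _)
          (i₁.add i₂) (Eventually.of_forall fun t ↦ ?_)
        refine (abs_sub _ _).trans_eq ?_
        rw [abs_mul, abs_mul, abs_of_nonneg hc₁, abs_of_nonneg hc₂]
    _ = _ := by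
        rw [MeasureTheory.integral_add i₁ i₂, MeasureTheory.integral_const_mul,
          MeasureTheory.integral_const_mul, integral_abs_comp_mul_sub f h₁,
          integral_abs_comp_mul_sub f h₂]
        ring

theorem deriv_smoothTransition_eq_zero {x : ℝ} (hx : x ∉ Set.Icc (0 : ℝ) 1) :
    deriv Real.smoothTransition x = 0 := by
  rw [Set.mem_Icc, not_and_or, not_le, not_le] at hx
  rcases hx with hx | hx
  · have : Real.smoothTransition =ᶠ[nhds x] fun _ ↦ 0 := by
      filter_upwards [eventually_lt_nhds hx] with y hy using
        Real.smoothTransition.zero_of_nonpos hy.le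
    rw [this.deriv_eq, deriv_const]
  · have : Real.smoothTransition =ᶠ[nhds x] fun _ ↦ 1 := by
      filter_upwards [eventually_gt_nhds hx] with y hy using
        Real.smoothTransition.one_of_one_le hy.le
    rw [this.deriv_eq, deriv_const]

/-- The first two derivatives of the dyadic bump have `L¹` norms `O(1)` and `O(1 / δ)`. -/
theorem exists_integral_abs_deriv_dyadicBump_le :
    ∃ B, ∀ δ : ℝ, 0 < δ → ∫ t, |deriv (dyadicBump δ) t| ≤ B ∧
      ∫ t, |deriv (deriv (dyadicBump δ)) t| ≤ B / δ := by
  have hS : ContDiff ℝ (2 : ℕ∞) Real.smoothTransition := Real.smoothTransition.contDiff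
  have hS' : ContDiff ℝ 1 (deriv Real.smoothTransition) :=
    ((contDiff_succ_iff_deriv (n := 1)).mp (by simpa [one_add_one_eq_two] using hS)).2.2
  have hc : HasCompactSupport (deriv Real.smoothTransition) :=
    HasCompactSupport.intro isCompact_Icc fun x hx ↦ deriv_smoothTransition_eq_zero hx
  have hi := hS'.continuous.integrable_of_hasCompactSupport (μ := MeasureTheory.volume) hc
  have hi' := (hS'.continuous_deriv le_rfl).integrable_of_hasCompactSupport
    (μ := MeasureTheory.volume) hc.deriv
  set V := ∫ t, |deriv Real.smoothTransition t|
  set W := ∫ t, |deriv (deriv Real.smoothTransition) t|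
  have hV : 0 ≤ V := MeasureTheory.integral_nonneg fun _ ↦ abs_nonneg _
  have hW : 0 ≤ W := MeasureTheory.integral_nonneg fun _ ↦ abs_nonneg _
  -- The `L¹` norm of a first derivative is invariant under rescaling, so two pieces give `2 * V`.
  -- Second derivatives scale with the slopes `2 / δ` and `1 / δ`, giving `3 * W / δ`.
  refine ⟨2 * V + 3 * W, fun δ hδ ↦ ?_⟩
  have hδ' := inv_pos.mpr hδ
  have e1 : dyadicBump δ = fun t ↦ 1 * Real.smoothTransition (2 * δ⁻¹ * t - δ⁻¹) -
      1 * Real.smoothTransition (δ⁻¹ * t - δ⁻¹) := by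
    simp only [one_mul, dyadicBump_eq]
  have e2 : deriv (dyadicBump δ) = _ :=
    (congrArg deriv e1).trans (deriv_sub_comp_mul_sub (hS.differentiable (by norm_num)) ..)
  have e3 : deriv (deriv (dyadicBump δ)) = _ :=
    (congrArg deriv e2).trans (deriv_sub_comp_mul_sub (hS'.differentiable (by norm_num)) ..)
  constructor
  · rw [e2]
    refine (integral_abs_sub_comp_mul_sub_le hi (by positivity) hδ' (by positivity)
      (by positivity) _).trans ?_
    have : 1 * (2 * δ⁻¹) * (2 * δ⁻¹)⁻¹ + 1 * δ⁻¹ * δ⁻¹⁻¹ = 2 := by field_simp; norm_num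
    rw [this]
    linarith
  · rw [e3]
    refine (integral_abs_sub_comp_mul_sub_le hi' (by positivity) hδ' (by positivity)
      (by positivity) _).trans ?_
    have : 1 * (2 * δ⁻¹) * (2 * δ⁻¹) * (2 * δ⁻¹)⁻¹ + 1 * δ⁻¹ * δ⁻¹ * δ⁻¹⁻¹ = 3 / δ := by
      field_simp; norm_num
    rw [this, div_mul_eq_mul_div]
    gcongr
    linarith

theorem integrableOn_smoothCutoff (hδ : 0 < δ) :
    MeasureTheory.IntegrableOn (smoothCutoff δ) (Set.Ioi 0) := by
  have h1 : MeasureTheory.IntegrableOn (smoothCutoff δ) (Set.Ioc 0 (1 + δ)) :=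
    (contDiff_smoothCutoff.continuous.integrableOn_Icc).mono_set Set.Ioc_subset_Icc_self
  refine h1.of_forall_sdiff_eq_zero measurableSet_Ioi fun t ht ↦ smoothCutoff_of_le hδ ?_
  by_contra h
  exact ht.2 ⟨ht.1, (not_le.mp h).le⟩

theorem integral_dyadicBump (hδ : 0 < δ) :
    ∫ t in Set.Ioi 0, dyadicBump δ t = 1 / 2 * ∫ t in Set.Ioi 0, smoothCutoff δ t := by
  have h1 := integrableOn_smoothCutoff hδ
  have h2 : MeasureTheory.IntegrableOn (fun t ↦ smoothCutoff δ (2 * t)) (Set.Ioi 0) := by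
    rw [MeasureTheory.integrableOn_Ioi_comp_mul_left_iff _ _ (by norm_num), mul_zero]
    exact h1
  have h3 := MeasureTheory.integral_comp_mul_left_Ioi (smoothCutoff δ) 0 (b := 2) (by norm_num)
  simp only [dyadicBump]
  rw [MeasureTheory.integral_sub h1 h2, h3, mul_zero, smul_eq_mul]
  ring

theorem one_le_integral_smoothCutoff (hδ : 0 < δ) : 1 ≤ ∫ t in Set.Ioi 0, smoothCutoff δ t := by
  calc (1 : ℝ) = ∫ t in Set.Ioc (0 : ℝ) 1, (1 : ℝ) := by simp
    _ = ∫ t in Set.Ioc (0 : ℝ) 1, smoothCutoff δ t :=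
        MeasureTheory.setIntegral_congr_fun measurableSet_Ioc fun t ht ↦
          (smoothCutoff_of_le_one hδ ht.2).symm
    _ ≤ _ := MeasureTheory.setIntegral_mono_set (integrableOn_smoothCutoff hδ)
        (Eventually.of_forall smoothCutoff_nonneg)
        Set.Ioc_subset_Ioi_self.eventuallyLE

theorem integral_smoothCutoff_le (hδ : 0 < δ) :
    ∫ t in Set.Ioi 0, smoothCutoff δ t ≤ 1 + δ := by
  calc _ = ∫ t in Set.Ioc (0 : ℝ) (1 + δ), smoothCutoff δ t := by
        refine (MeasureTheory.setIntegral_eq_of_subset_of_forall_sdiff_eq_zero measurableSet_Ioi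
          Set.Ioc_subset_Ioi_self fun t ht ↦ smoothCutoff_of_le hδ ?_)
        by_contra h
        exact ht.2 ⟨ht.1, (not_le.mp h).le⟩
    _ ≤ ∫ t in Set.Ioc (0 : ℝ) (1 + δ), (1 : ℝ) :=
        MeasureTheory.setIntegral_mono_on ((integrableOn_smoothCutoff hδ).mono_set
          Set.Ioc_subset_Ioi_self) (by simp) measurableSet_Ioc fun t _ ↦ smoothCutoff_le_one t
    _ = 1 + δ := by simp [hδ.le, add_nonneg]

end Bump

/-! ### Sharp and smooth counts of ideals -/

section Counting

variable {K : Type*} [Field K] [NumberField K]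

variable (K) in
theorem finite_setOf_absNorm_le (x : ℝ) :
    {I : (Ideal (𝓞 K))⁰ | (Ideal.absNorm I.1 : ℝ) ≤ x}.Finite := by
  refine (Ideal.finite_setOfPred_absNorm_le₀ ⌊x⌋₊).subset fun I hI ↦ ?_
  exact Nat.le_floor hI

variable (K) in
theorem hasSum_idealCount (x : ℝ) :
    HasSum (fun I : (Ideal (𝓞 K))⁰ ↦
      Set.indicator {I : (Ideal (𝓞 K))⁰ | (Ideal.absNorm I.1 : ℝ) ≤ x} (fun _ ↦ (1 : ℝ)) I)
      (idealCount K x) := by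
  have hf := finite_setOf_absNorm_le K x
  have h1 : (idealCount K x : ℝ) = ∑ I ∈ hf.toFinset,
      Set.indicator {I : (Ideal (𝓞 K))⁰ | (Ideal.absNorm I.1 : ℝ) ≤ x} (fun _ ↦ (1 : ℝ)) I := by
    have h2 : idealCount K x = hf.toFinset.card := Nat.card_eq_card_finite_toFinset hf
    rw [h2, Finset.card_eq_sum_ones, Nat.cast_sum]
    refine Finset.sum_congr rfl fun I hI ↦ ?_
    rw [Set.indicator_of_mem (hf.mem_toFinset.mp hI), Nat.cast_one]
  rw [h1]
  exact hasSum_sum_of_ne_finset_zero fun I hI ↦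
    Set.indicator_of_notMem (fun h ↦ hI (hf.mem_toFinset.mpr h)) _

variable (K) in
/-- The number of ideals of norm at most `1 / t`, with a smooth cutoff. -/
noncomputable def smoothIdealCount (δ t : ℝ) : ℝ :=
  ∑' I : (Ideal (𝓞 K))⁰, smoothCutoff δ (t * (Ideal.absNorm I.1 : ℝ))

variable {δ : ℝ}

theorem summable_smoothCutoff_absNorm (hδ : 0 < δ) {t : ℝ} (ht : 0 < t) :
    Summable fun I : (Ideal (𝓞 K))⁰ ↦ smoothCutoff δ (t * (Ideal.absNorm I.1 : ℝ)) := by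
  refine summable_of_hasFiniteSupport
    ((finite_setOf_absNorm_le K ((1 + δ) / t)).subset fun I hI ↦ ?_)
  by_contra hc
  refine hI (smoothCutoff_of_le hδ ?_)
  have h1 : (1 + δ) / t < (Ideal.absNorm I.1 : ℝ) := not_le.mp fun h ↦ hc h
  rw [div_lt_iff₀ ht, mul_comm] at h1
  exact h1.le

/-- Upper half of the sandwich: at scale `1 / x` the cutoff majorises the indicator of norms up to
`x`. At scale `(1 + δ) / x`, in the next lemma, it minorises it. -/
theorem idealCount_le_smoothIdealCount (hδ : 0 < δ) {x : ℝ} (hx : 0 < x) :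
    (idealCount K x : ℝ) ≤ smoothIdealCount K δ (1 / x) := by
  refine hasSum_le (fun I ↦ ?_) (hasSum_idealCount K x)
    (summable_smoothCutoff_absNorm hδ (one_div_pos.mpr hx)).hasSum
  by_cases h : (Ideal.absNorm I.1 : ℝ) ≤ x
  · rw [smoothCutoff_of_le_one hδ (by rw [one_div_mul_eq_div, div_le_one hx]; exact h)]
    exact Set.indicator_le_self' (fun _ _ ↦ zero_le_one) I
  · rw [Set.indicator_of_notMem
      (show I ∉ {I : (Ideal (𝓞 K))⁰ | (Ideal.absNorm I.1 : ℝ) ≤ x} from h)]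
    exact smoothCutoff_nonneg _

theorem smoothIdealCount_le_idealCount (hδ : 0 < δ) {x : ℝ} (hx : 0 < x) :
    smoothIdealCount K δ ((1 + δ) / x) ≤ idealCount K x := by
  refine hasSum_le (fun I ↦ ?_)
    (summable_smoothCutoff_absNorm hδ (by positivity)).hasSum (hasSum_idealCount K x)
  by_cases h : (Ideal.absNorm I.1 : ℝ) ≤ x
  · rw [Set.indicator_of_mem
      (show I ∈ {I : (Ideal (𝓞 K))⁰ | (Ideal.absNorm I.1 : ℝ) ≤ x} from h)]
    exact smoothCutoff_le_one _
  · rw [smoothCutoff_of_le hδ]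
    · exact Set.indicator_nonneg (fun _ _ ↦ zero_le_one) I
    · rw [div_mul_eq_mul_div, le_div_iff₀ hx]
      gcongr
      exact (not_le.mp h).le

theorem smoothIdealCount_eq_zero (hδ : 0 < δ) (hδ1 : δ ≤ 1) {t : ℝ} (ht : 2 ≤ t) :
    smoothIdealCount K δ t = 0 := by
  rw [smoothIdealCount, tsum_congr, tsum_zero]
  intro I
  refine smoothCutoff_of_le hδ ?_
  have h1 : (1 : ℝ) ≤ (Ideal.absNorm I.1 : ℝ) := by
    exact_mod_cast Nat.one_le_iff_ne_zero.mpr (Ideal.absNorm_ne_zero_of_nonZeroDivisors I)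
  nlinarith

theorem idealSum_dyadicBump (hδ : 0 < δ) {t : ℝ} (ht : 0 < t) :
    idealSum K (dyadicBump δ) t = smoothIdealCount K δ t - smoothIdealCount K δ (2 * t) := by
  have hg := isTestFunction_dyadicBump hδ
  have h0 : dyadicBump δ 0 = 0 := by simp [dyadicBump]
  rw [idealSum_eq_tsum hg.hasCompactSupport h0 ht, smoothIdealCount, smoothIdealCount,
    ← (summable_smoothCutoff_absNorm hδ ht).tsum_sub
      (summable_smoothCutoff_absNorm hδ (by linarith))]
  simp only [dyadicBump, mul_assoc]

/-- The cutoff is not supported away from `0`, so it is not a test function; its dyadic differences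
are. The sum telescopes, and the last term vanishes because norms are at least `1` and `1 + δ ≤ 2`.
-/
theorem smoothIdealCount_eq_sum (hδ : 0 < δ) (hδ1 : δ ≤ 1) {t : ℝ} (ht : 0 < t) {N : ℕ}
    (hN : 2 ≤ 2 ^ N * t) :
    smoothIdealCount K δ t = ∑ k ∈ Finset.range N, idealSum K (dyadicBump δ) (2 ^ k * t) := by
  have h1 : ∀ k ∈ Finset.range N, idealSum K (dyadicBump δ) (2 ^ k * t) =
      smoothIdealCount K δ (2 ^ k * t) - smoothIdealCount K δ (2 ^ (k + 1) * t) := fun k _ ↦ by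
    rw [idealSum_dyadicBump hδ (by positivity), pow_succ', mul_assoc 2]
  rw [Finset.sum_congr rfl h1, Finset.sum_range_sub' fun k ↦ smoothIdealCount K δ (2 ^ k * t),
    smoothIdealCount_eq_zero hδ hδ1 hN]
  simp

end Counting

/-! ### Summation of the dyadic pieces and choice of the width -/

section Asymptotic

variable {K : Type*} [Field K] [NumberField K]

theorem sum_two_pow_mul_rpow_le {t : ℝ} (ht : 0 < t) (N : ℕ) :
    ∑ k ∈ Finset.range N, (2 ^ k * t) ^ (-(1 / 2 : ℝ)) ≤ 4 * t ^ (-(1 / 2 : ℝ)) := by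
  -- A convenient rational ratio below `1`; the `4` is `1 / (1 - 3 / 4)`.
  have h2 : (2 : ℝ) ^ (-(1 / 2 : ℝ)) ≤ 3 / 4 := by
    refine abs_le_of_sq_le_sq' ?_ (by norm_num) |>.2
    rw [← Real.rpow_natCast, ← Real.rpow_mul (by norm_num)]
    norm_num
  have h1 : ∀ k ∈ Finset.range N, (2 ^ k * t) ^ (-(1 / 2 : ℝ)) ≤
      (3 / 4) ^ k * t ^ (-(1 / 2 : ℝ)) := fun k _ ↦ by
    rw [Real.mul_rpow (by positivity) ht.le, ← Real.rpow_natCast_mul (by norm_num), mul_comm (k : ℝ),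
      Real.rpow_mul_natCast (by norm_num)]
    gcongr
  refine (Finset.sum_le_sum h1).trans ?_
  rw [← Finset.sum_mul, geom_sum_eq (by norm_num)]
  gcongr
  have : (0 : ℝ) ≤ (3 / 4) ^ N := by positivity
  rw [div_le_iff_of_neg (by norm_num)]
  linarith

theorem sum_div_two_pow_mul (C t : ℝ) (N : ℕ) :
    ∑ k ∈ Finset.range N, C / (2 ^ k * t) = 2 * C / t - 2 * C / (2 ^ N * t) := by
  induction N with
  | zero => simp
  | succ n ih =>
    rw [Finset.sum_range_succ, ih, pow_succ']
    rcases eq_or_ne t 0 with rfl | ht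
    · simp
    · field_simp; ring

/-- Errors and main terms at the scales `2 ^ k * t` both form geometric series. Stopping at `2 ^ N *
t ≥ 2` truncates the main term `2 * C / t` by at most `|C|`. -/
theorem abs_smoothIdealCount_sub_le {δ : ℝ} (hδ : 0 < δ) (hδ1 : δ ≤ 1) {C M : ℝ}
    (hM : 0 ≤ M)
    (h : ∀ t, 0 < t → |idealSum K (dyadicBump δ) t - C / t| ≤ M * t ^ (-(1 / 2 : ℝ)))
    {t : ℝ} (ht : 0 < t) (ht1 : t ≤ 1) :
    |smoothIdealCount K δ t - 2 * C / t| ≤ (4 * M + |C|) * t ^ (-(1 / 2 : ℝ)) := by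
  obtain ⟨N, hN⟩ := pow_unbounded_of_one_lt (2 / t) (one_lt_two (α := ℝ))
  have hN' : 2 ≤ 2 ^ N * t := ((div_lt_iff₀ ht).mp hN).le
  have h1 : smoothIdealCount K δ t - 2 * C / t = ∑ k ∈ Finset.range N,
      (idealSum K (dyadicBump δ) (2 ^ k * t) - C / (2 ^ k * t)) - 2 * C / (2 ^ N * t) := by
    rw [Finset.sum_sub_distrib, ← smoothIdealCount_eq_sum hδ hδ1 ht hN', sum_div_two_pow_mul]
    ring
  have h2 : |∑ k ∈ Finset.range N,
      (idealSum K (dyadicBump δ) (2 ^ k * t) - C / (2 ^ k * t))| ≤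
        M * (4 * t ^ (-(1 / 2 : ℝ))) := by
    refine (Finset.abs_sum_le_sum_abs _ _).trans ((Finset.sum_le_sum fun k _ ↦
      h (2 ^ k * t) (by positivity)).trans ?_)
    rw [← Finset.mul_sum]
    exact mul_le_mul_of_nonneg_left (sum_two_pow_mul_rpow_le ht N) hM
  have h3 : |2 * C / (2 ^ N * t)| ≤ |C| := by
    rw [abs_div, abs_mul, abs_two, abs_of_pos (by positivity : 0 < 2 ^ N * t),
      div_le_iff₀ (by positivity), mul_comm]
    exact mul_le_mul_of_nonneg_left hN' (abs_nonneg C)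
  have h4 : 1 ≤ t ^ (-(1 / 2 : ℝ)) :=
    Real.one_le_rpow_of_pos_of_le_one_of_nonpos ht ht1 (by norm_num)
  rw [h1]
  calc _ ≤ M * (4 * t ^ (-(1 / 2 : ℝ))) + |C| * 1 := by
        rw [mul_one]; exact (abs_sub _ _).trans (add_le_add h2 h3)
    _ ≤ M * (4 * t ^ (-(1 / 2 : ℝ))) + |C| * t ^ (-(1 / 2 : ℝ)) := by gcongr
    _ = _ := by ring

/-- Needed for all `t > 0`, since the dyadic scales `2 ^ k * t` pass beyond `1`, where the kernel is
`0`. -/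
theorem abs_poleKernel_sub_le {t : ℝ} (ht : 0 < t) :
    |poleKernel t - 1 / t| ≤ t ^ (-(1 / 2 : ℝ)) := by
  rcases le_total 1 t with h | h
  · rw [poleKernel_of_one_le h, zero_sub, abs_neg, abs_of_pos (by positivity), one_div,
      ← Real.rpow_neg_one]
    exact Real.rpow_le_rpow_of_exponent_le h (by norm_num)
  · rw [poleKernel_of_le_one ht h, sub_sub_cancel_left, abs_neg, abs_one]
    exact Real.one_le_rpow_of_pos_of_le_one_of_nonpos ht h (by norm_num)

/-- Under the Lindelöf hypothesis, the smoothed ideal counting function has a square root error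
term. -/
theorem ExtendedLindelofHypothesis.exists_abs_smoothIdealCount_sub_le
    (hELH : ExtendedLindelofHypothesis K) {ε : ℝ} (hε : 0 < ε) (hε1 : 2 * ε ≤ 1) :
    ∃ E, 0 ≤ E ∧ ∀ δ : ℝ, 0 < δ → δ ≤ 1 → ∀ t : ℝ, 0 < t → t ≤ 1 →
      |smoothIdealCount K δ t - dedekindZeta_residue K *
        (∫ u in Set.Ioi 0, smoothCutoff δ u) / t| ≤ E * δ ^ (-(2 * ε)) * t ^ (-(1 / 2 : ℝ)) := by
  obtain ⟨A, hA0, hA⟩ := hELH.exists_abs_idealSumRemainder_le hε hε1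
  obtain ⟨B, hB⟩ := exists_integral_abs_deriv_dyadicBump_le
  have hB0 : 0 ≤ B :=
    (MeasureTheory.integral_nonneg fun _ ↦ abs_nonneg _).trans (hB 1 one_pos).1
  have hρ := (dedekindZeta_residue_pos K).le
  set ρ := dedekindZeta_residue K
  refine ⟨4 * (A * (B + ρ) + ρ) + ρ, by positivity, fun δ hδ hδ1 t ht ht1 ↦ ?_⟩
  have hI1 := one_le_integral_smoothCutoff hδ
  have hI2 := integral_smoothCutoff_le hδ
  have hg := isTestFunction_dyadicBump hδ
  have hd : 1 ≤ δ ^ (-(2 * ε)) :=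
    Real.one_le_rpow_of_pos_of_le_one_of_nonpos hδ hδ1 (by linarith)
  have hrem := hA _ hg (dyadicBump_eq_zero hδ hδ1) B δ hδ (hB δ hδ).1 (hB δ hδ).2
  simp only [idealSumRemainder, integral_dyadicBump hδ] at hrem
  set J := ∫ u in Set.Ioi 0, smoothCutoff δ u
  set C := ρ * (1 / 2 * J) with hC
  have hC0 : 0 ≤ C := by positivity
  -- From `J ≤ 1 + δ ≤ 2`; this keeps the final constant independent of `δ`.
  have hCρ : C ≤ ρ := by
    rw [hC]; exact mul_le_of_le_one_right hρ (by linarith)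
  rw [abs_of_nonneg hC0] at hrem
  have h1 : ∀ t, 0 < t → |idealSum K (dyadicBump δ) t - C / t| ≤
      (A * (B + ρ) + ρ) * δ ^ (-(2 * ε)) * t ^ (-(1 / 2 : ℝ)) := fun t ht ↦ by
    have e1 := hrem t ht
    have e2 := abs_poleKernel_sub_le ht
    have e3 : idealSum K (dyadicBump δ) t - C / t =
      (idealSum K (dyadicBump δ) t - C * poleKernel t) + C * (poleKernel t - 1 / t) := by ring
    have hw : 0 ≤ t ^ (-(1 / 2 : ℝ)) := by positivity
    calc _ ≤ |idealSum K (dyadicBump δ) t - C * poleKernel t| +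
            |C * (poleKernel t - 1 / t)| := by rw [e3]; exact abs_add_le _ _
      _ ≤ A * (B * δ ^ (-(2 * ε)) + C) * t ^ (-(1 / 2 : ℝ)) + C * t ^ (-(1 / 2 : ℝ)) := by
          rw [abs_mul, abs_of_nonneg hC0]; gcongr
      _ ≤ A * (B * δ ^ (-(2 * ε)) + ρ * δ ^ (-(2 * ε))) * t ^ (-(1 / 2 : ℝ)) +
            ρ * δ ^ (-(2 * ε)) * t ^ (-(1 / 2 : ℝ)) := by
          have : C ≤ ρ * δ ^ (-(2 * ε)) := hCρ.trans (le_mul_of_one_le_right hρ hd)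
          gcongr
      _ = _ := by ring
  have h2 := abs_smoothIdealCount_sub_le hδ hδ1 (by positivity) h1 ht ht1
  have h3 : 2 * C / t = ρ * J / t := by rw [hC]; ring
  rw [h3, abs_of_nonneg hC0] at h2
  refine h2.trans ?_
  gcongr
  have : C ≤ ρ * δ ^ (-(2 * ε)) := hCρ.trans (le_mul_of_one_le_right hρ hd)
  linarith

/-- With `δ = x ^ (-1/2)`, smoothing costs `ρ * δ * x = ρ * x ^ (1/2)`, and the factor `δ ^ (-2ε)`
in the smooth error is `x ^ ε`. -/
theorem abs_idealCount_sub_le {ε E : ℝ} (hE : 0 ≤ E)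
    (h : ∀ δ : ℝ, 0 < δ → δ ≤ 1 → ∀ t : ℝ, 0 < t → t ≤ 1 →
      |smoothIdealCount K δ t - dedekindZeta_residue K *
        (∫ u in Set.Ioi 0, smoothCutoff δ u) / t| ≤ E * δ ^ (-(2 * ε)) * t ^ (-(1 / 2 : ℝ)))
    (hε : 0 ≤ ε) {x : ℝ} (hx : 2 ≤ x) :
    |(idealCount K x : ℝ) - dedekindZeta_residue K * x| ≤
      (dedekindZeta_residue K + E) * x ^ (1 / 2 + ε) := by
  have hx0 : 0 < x := by linarith
  have hρ := (dedekindZeta_residue_pos K).le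
  set ρ := dedekindZeta_residue K
  set δ := x ^ (-(1 / 2 : ℝ)) with hδdef
  have hδ : 0 < δ := by positivity
  have hδ1 : δ ≤ 1 := Real.rpow_le_one_of_one_le_of_nonpos (by linarith) (by norm_num)
  have hδx : δ * x = x ^ (1 / 2 : ℝ) := by
    rw [hδdef, ← Real.rpow_add_one hx0.ne']; norm_num
  have hδε : δ ^ (-(2 * ε)) = x ^ ε := by
    rw [hδdef, ← Real.rpow_mul hx0.le]; ring_nf
  have hI1 := one_le_integral_smoothCutoff hδ
  have hI2 := integral_smoothCutoff_le hδ
  have hup := idealCount_le_smoothIdealCount (K := K) hδ hx0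
  have hlo := smoothIdealCount_le_idealCount (K := K) hδ hx0
  have a1 := (abs_le.mp (h δ hδ hδ1 (1 / x) (by positivity)
    (by rw [div_le_one hx0]; linarith))).2
  have a2 := (abs_le.mp (h δ hδ hδ1 ((1 + δ) / x) (by positivity)
    (by rw [div_le_one hx0]; linarith))).1
  set J := ∫ u in Set.Ioi 0, smoothCutoff δ u
  have b0 : (1 / x) ^ (-(1 / 2 : ℝ)) = x ^ (1 / 2 : ℝ) := by
    rw [one_div, Real.inv_rpow hx0.le, Real.rpow_neg hx0.le, inv_inv]
  have b2 : ((1 + δ) / x) ^ (-(1 / 2 : ℝ)) ≤ x ^ (1 / 2 : ℝ) := by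
    rw [← b0]
    refine Real.rpow_le_rpow_of_nonpos (by positivity) ?_ (by norm_num)
    gcongr
    linarith
  have hpow : x ^ (1 / 2 + ε) = x ^ ε * x ^ (1 / 2 : ℝ) := by
    rw [add_comm, Real.rpow_add hx0]
  have hxε : 1 ≤ x ^ ε := Real.one_le_rpow (by linarith) hε
  have hxh : 0 ≤ x ^ (1 / 2 : ℝ) := by positivity
  have hρx : ρ * x ^ (1 / 2 : ℝ) ≤ ρ * (x ^ ε * x ^ (1 / 2 : ℝ)) := by
    gcongr
    exact le_mul_of_one_le_left hxh hxε
  rw [b0, hδε] at a1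
  rw [hδε] at a2
  have a3 : ρ * J / (1 / x) ≤ ρ * x + ρ * x ^ (1 / 2 : ℝ) := by
    rw [div_div_eq_mul_div, div_one, ← hδx]
    calc ρ * J * x ≤ ρ * (1 + δ) * x := by gcongr
      _ = _ := by ring
  -- This amounts to `(1 - δ) * (1 + δ) ≤ 1 ≤ J`.
  have a4 : ρ * x - ρ * x ^ (1 / 2 : ℝ) ≤ ρ * J / ((1 + δ) / x) := by
    rw [← hδx, div_div_eq_mul_div, le_div_iff₀ (by positivity)]
    have e1 : ρ * x * 1 ≤ ρ * x * J := by gcongr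
    have e2 : 0 ≤ ρ * x * δ ^ 2 := by positivity
    linarith
  have a5 : E * x ^ ε * ((1 + δ) / x) ^ (-(1 / 2 : ℝ)) ≤ E * x ^ ε * x ^ (1 / 2 : ℝ) := by
    gcongr
  rw [hpow, abs_le]
  constructor <;> linarith

end Asymptotic

theorem theorem3p2 (K : Type*) [Field K] [NumberField K]
    (hELH : ExtendedLindelofHypothesis K) (ε : ℝ) (hε : 0 < ε) :
    (fun x : ℝ ↦ (idealCount K x : ℝ) -
        (2 ^ InfinitePlace.nrRealPlaces K * (2 * π) ^ InfinitePlace.nrComplexPlaces K *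
            (classNumber K : ℝ) * Units.regulator K) /
          ((Units.torsionOrder K : ℝ) * Real.sqrt |(discr K : ℝ)|) * x)
      =O[atTop] (fun x : ℝ ↦ x ^ (1 / 2 + ε)) := by
  -- The interpolation exponent `2 * ε` may not exceed `1`; a smaller exponent only strengthens the
  -- bound.
  have hη : 0 < min ε (1 / 2) := lt_min hε (by norm_num)
  have hη1 : min ε (1 / 2) ≤ 1 / 2 := min_le_right _ _
  obtain ⟨E, hE, h⟩ := hELH.exists_abs_smoothIdealCount_sub_le hη (by linarith)
  have hρ := (dedekindZeta_residue_pos K).le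
  refine IsBigO.of_bound (dedekindZeta_residue K + E) ?_
  filter_upwards [eventually_ge_atTop (2 : ℝ)] with x hx
  have hx0 : 0 < x := by linarith
  have h1 := abs_idealCount_sub_le hE h hη.le hx
  rw [show dedekindZeta_residue K = (2 ^ InfinitePlace.nrRealPlaces K *
      (2 * π) ^ InfinitePlace.nrComplexPlaces K * (classNumber K : ℝ) * Units.regulator K) /
      ((Units.torsionOrder K : ℝ) * Real.sqrt |(discr K : ℝ)|) by
    rw [dedekindZeta_residue_def]; ring] at h1 hρ ⊢
  rw [Real.norm_eq_abs, Real.norm_of_nonneg (by positivity)]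
  refine h1.trans ?_
  gcongr
  · linarith
  · exact min_le_left _ _
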